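/- Let $n\ge 4$. For a partition $\lambda$ of $n$ let $\psi^{\lambda}$ be the character of the complex Specht module $S^{\lambda}$ of the symmetric group $S_n$ (the span of the polytabloids of shape $\lambda$), and let $\chi^{\lambda}=\psi^{\lambda}\!\downarrow_{A_n}$ be its restriction to the alternating group $A_n$. Let $\chi^{\mathrm{def}}$ be the character of the defining representation $\rho^{\mathrm{def}}$ of $S_n$ on $\mathbb{C}[n]$ by permutation of the basis vectors (so $\chi^{\mathrm{def}}(\pi)$ is the number of fixed points of $\pi$), and let $\chi^{\mathrm{def}}\otimes\chi^{\mathrm{def}}$ be the character of $\rho^{\mathrm{def}}\otimes\rho^{\mathrm{def}}$. Then \[\left(\chi^{\mathrm{def}}\otimes\chi^{\mathrm{def}}\right)\downarrow_{A_n}=2\,\chi^{(n)}+3\,\chi^{(n-1,1)}+\chi^{(n-2,2)}+\chi^{(n-2,1,1)}.\] Moreover, for each $\lambda\in\{(n),(n-1,1),(n-2,2),(n-2,1,1)\}$ that is not equal to its conjugate partition (for $n\ge 6$, all four of them), $\chi^{\lambda}$ is an irreducible character of $A_n$. -/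

import Mathlib

noncomputable section

namespace SpechtTheory

open Equiv

/-- A Young tableau of shape `μ`: a bijective filling of the boxes of `μ` by the `n` letters. -/
abbrev Tableau (n : ℕ) (μ : YoungDiagram) : Type :=
  {c : ℕ × ℕ // c ∈ μ.cells} ≃ Fin n

/-- A tabloid of shape `μ` (a tableau up to permuting the entries of each row), recorded by the
row index of every letter: the `i`-th row has to contain exactly `μ.rowLen i` letters. -/
def Tabloid (n : ℕ) (μ : YoungDiagram) : Type :=
  {r : Fin n → ℕ // ∀ i : ℕ, (Finset.univ.filter fun k => r k = i).card = μ.rowLen i}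

variable {n : ℕ} {μ : YoungDiagram}

/-- `Sₙ` permutes tabloids by acting on the letters. -/
instance : MulAction (Perm (Fin n)) (Tabloid n μ) where
  smul σ r := ⟨fun k => r.1 (σ⁻¹ k), fun i => by
    rw [← r.2 i]
    refine Finset.card_bij (fun k _ => σ⁻¹ k) ?_ ?_ ?_
    · intro k hk
      simpa using hk
    · intro a _ b _ h
      exact σ⁻¹.injective h
    · intro k hk
      exact ⟨σ k, by simpa using hk, by simp⟩⟩
  one_smul r := Subtype.ext (funext fun k => rfl)
  mul_smul σ τ r := Subtype.ext (funext fun k => by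
    change r.1 ((σ * τ)⁻¹ k) = r.1 (τ⁻¹ (σ⁻¹ k))
    rw [mul_inv_rev, Perm.mul_apply])

/-- The action of a permutation on a tableau, by replacing each entry by its image. -/
def Tableau.act (σ : Perm (Fin n)) (T : Tableau n μ) : Tableau n μ := T.trans σ

/-- The tabloid `{T}` of a tableau `T`. -/
def Tableau.tabloid (T : Tableau n μ) : Tabloid n μ :=
  ⟨fun k => (T.symm k).1.1, fun i => by
    rw [YoungDiagram.rowLen_eq_card]
    refine Finset.card_bij (fun k _ => (T.symm k).1) ?_ ?_ ?_
    · intro k hk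
      rw [YoungDiagram.mem_row_iff]
      exact ⟨(T.symm k).2, by simpa using hk⟩
    · intro a _ b _ h
      exact T.symm.injective (Subtype.ext h)
    · intro c hc
      rw [YoungDiagram.mem_row_iff] at hc
      exact ⟨T ⟨c, hc.1⟩, by simpa using hc.2, by simp⟩⟩

theorem Tableau.tabloid_act (σ : Perm (Fin n)) (T : Tableau n μ) :
    Tableau.tabloid (Tableau.act σ T) = σ • Tableau.tabloid T := rfl

/-- The permutations that preserve every column of the tableau `T`. -/
def Tableau.columnStabilizer (T : Tableau n μ) : Finset (Perm (Fin n)) :=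
  Finset.univ.filter fun σ => ∀ k, (T.symm (σ k)).1.2 = (T.symm k).1.2

/-- The permutation representation `M^μ` of `Sₙ` on the tabloids of shape `μ`. -/
def tabloidRep (n : ℕ) (μ : YoungDiagram) :
    Representation ℂ (Perm (Fin n)) (MonoidAlgebra ℂ (Tabloid n μ)) :=
  Representation.ofMulAction ℂ (Perm (Fin n)) (Tabloid n μ)

/-- The polytabloid `e_T = ∑ sgn(σ) {σ T}`, summed over the column stabilizer of `T`. -/
def Tableau.polytabloid (T : Tableau n μ) : MonoidAlgebra ℂ (Tabloid n μ) :=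
  ∑ σ ∈ T.columnStabilizer,
    (((Perm.sign σ : ℤˣ) : ℤ) : ℂ) • MonoidAlgebra.single (Tableau.tabloid (Tableau.act σ T)) (1 : ℂ)

theorem tabloidRep_polytabloid (σ : Perm (Fin n)) (T : Tableau n μ) :
    tabloidRep n μ σ (Tableau.polytabloid T) = Tableau.polytabloid (Tableau.act σ T) := by
  unfold Tableau.polytabloid
  rw [map_sum]
  refine Finset.sum_bij (fun τ _ => σ * τ * σ⁻¹) ?_ ?_ ?_ ?_
  · intro τ hτ
    simp only [Tableau.columnStabilizer, Finset.mem_filter, Finset.mem_univ, true_and] at hτ ⊢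
    intro k
    have := hτ (σ⁻¹ k)
    have h : ∀ j, (Tableau.act σ T).symm j = T.symm (σ⁻¹ j) := fun _ => rfl
    rw [h, h, ← this, ← Perm.mul_apply, ← Perm.mul_apply, ← mul_assoc, ← mul_assoc,
      inv_mul_cancel, one_mul]
  · intro a _ b _ h
    simpa using h
  · intro τ hτ
    refine ⟨σ⁻¹ * τ * σ, ?_, by group⟩
    simp only [Tableau.columnStabilizer, Finset.mem_filter, Finset.mem_univ, true_and] at hτ ⊢
    intro k
    have := hτ (σ k)
    have h : ∀ j, (Tableau.act σ T).symm j = T.symm (σ⁻¹ j) := fun _ => rfl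
    rw [h, h, ← Perm.mul_apply, ← Perm.mul_apply, ← Perm.mul_apply, inv_mul_cancel] at this
    exact this
  · intro τ _
    rw [map_smul, tabloidRep, Representation.ofMulAction_single, Tableau.tabloid_act,
      Tableau.tabloid_act, Tableau.tabloid_act, ← mul_smul, ← mul_smul]
    rcases Int.units_eq_one_or (Perm.sign σ) with h | h <;> simp [h]

/-- The Specht module `S^μ`: the subrepresentation of `M^μ` spanned by all polytabloids. -/
def specht (n : ℕ) (μ : YoungDiagram) : Subrepresentation (tabloidRep n μ) where
  toSubmodule := Submodule.span ℂ (Set.range (Tableau.polytabloid (n := n) (μ := μ)))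
  apply_mem_toSubmodule σ v hv := by
    induction hv using Submodule.span_induction with
    | mem x hx =>
      obtain ⟨T, rfl⟩ := hx
      rw [tabloidRep_polytabloid]
      exact Submodule.subset_span ⟨_, rfl⟩
    | zero => simp
    | add x y _ _ hx hy => rw [map_add]; exact Submodule.add_mem _ hx hy
    | smul a x _ hx => rw [map_smul]; exact Submodule.smul_mem _ a hx

/-- The restriction of a representation of `Sₙ` to the alternating group `Aₙ`. -/
def resAlt {V : Type*} [AddCommGroup V] [Module ℂ V]
    (ρ : Representation ℂ (Perm (Fin n)) V) : Representation ℂ (alternatingGroup (Fin n)) V :=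
  ρ.comp (alternatingGroup (Fin n)).subtype

/-- The representation `D_μ` of `Aₙ` attached to `μ`: the restriction of the Specht module. -/
def altSpecht (n : ℕ) (μ : YoungDiagram) :
    Representation ℂ (alternatingGroup (Fin n)) (specht n μ).toSubmodule :=
  resAlt (specht n μ).toRepresentation

/-- The defining (permutation) representation of `Sₙ` on `ℂ[n]`. -/
def defRep (n : ℕ) : Representation ℂ (Perm (Fin n)) (MonoidAlgebra ℂ (Fin n)) :=
  Representation.ofMulAction ℂ (Perm (Fin n)) (Fin n)

end SpechtTheory

end

/-! All the representations are modelled inside functions on letters and on pairs of letters. Write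
a function on pairs as its symmetric part plus its antisymmetric part. The symmetric part splits
into `p i + p j`, a diagonal function and a symmetric function with zero diagonal and zero row sums.
The antisymmetric part splits into `v i - v j` with `v` of sum zero and an antisymmetric function
with zero row sums. Traces give fix² = 2 fix + χ(`sumZero`) + χ(`symZero`) + χ(`altZero`). Since fix
= 1 + χ(`sumZero`), the multiplicities 2, 3, 1, 1 follow.

Irreducibility comes from a fourth moment. By Burnside, the average of fix⁴ over the group is the
number of orbits on quadruples of letters. This is at most the Bell number 15 when the group is
transitive on quadruples with a given equality pattern. The squared multiplicities sum to 4 + 9 + 1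
+ 1 = 15, so there is no slack: every constituent has a one-dimensional endomorphism space
(`sum_char_of_patternTransitive`). This covers Sₙ for n ≥ 4 and Aₙ for n ≥ 6. The cases A₄ and A₅
are settled by enumeration, leaving out the self-conjugate (2,2) and (3,1,1).

To identify the Specht modules, each tabloid is sent to the indicator function of its lower rows.
This embeds `M^μ` equivariantly and carries polytabloids into `sumZero`, `symZero` or `altZero`. A
nonzero submodule of an irreducible module is everything, so the characters agree
(`character_specht_eq`). -/

namespace SpechtTheory

open Equiv Representation

/-! ### Irreducibility, characters and intertwiners -/

section General

variable {G V W : Type*} [Group G] [Fintype G] [AddCommGroup V] [Module ℂ V]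
  [FiniteDimensional ℂ V] [AddCommGroup W] [Module ℂ W] [FiniteDimensional ℂ W]

-- By Maschke a subrepresentation `S` has an invariant complement, and the projection onto `S` along
-- it is an intertwiner, hence a scalar `c`. If `c = 0` then `S` is zero; otherwise `S` is
-- everything.
omit [FiniteDimensional ℂ V] in
theorem isIrreducible_of_finrank_intertwiningMap_eq_one (ρ : Representation ℂ G V)
    (h : Module.finrank ℂ (IntertwiningMap ρ ρ) = 1) : ρ.IsIrreducible := by
  have hnt : Nontrivial V := by
    by_contra hV
    rw [not_nontrivial_iff_subsingleton] at hV
    have : Subsingleton (IntertwiningMap ρ ρ) :=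
      ⟨fun f g => IntertwiningMap.ext (LinearMap.ext fun v => Subsingleton.elim _ _)⟩
    rw [Module.finrank_zero_of_subsingleton] at h
    exact zero_ne_one h
  have hid : IntertwiningMap.id ρ ≠ 0 := by
    intro h0
    obtain ⟨v, hv⟩ := exists_ne (0 : V)
    apply hv
    have := congrArg (fun f : IntertwiningMap ρ ρ => f v) h0
    simpa using this
  have hbot : (⊥ : Subrepresentation ρ) ≠ ⊤ := by
    intro hbt
    exact bot_ne_top (α := Submodule ℂ V) (congrArg Subrepresentation.toSubmodule hbt)
  refine { exists_pair_ne := ⟨⊥, ⊤, hbot⟩, eq_bot_or_eq_top := fun S => ?_ }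
  have : NeZero (Nat.card G : ℂ) := ⟨by simp [Nat.card_eq_fintype_card]⟩
  obtain ⟨T, hT⟩ := exists_isCompl S
  have hc : IsCompl S.toSubmodule T.toSubmodule := by
    refine IsCompl.of_eq ?_ ?_
    · rw [← Subrepresentation.toSubmodule_inf, hT.inf_eq_bot]; rfl
    · rw [← Subrepresentation.toSubmodule_sup, hT.sup_eq_top]; rfl
  have hint : ∀ (g : G) (v : V), Submodule.projection S.toSubmodule T.toSubmodule hc (ρ g v) = ρ g (Submodule.projection S.toSubmodule T.toSubmodule hc v) := by
    intro g v
    have hv : v ∈ S.toSubmodule ⊔ T.toSubmodule := hc.sup_eq_top ▸ Submodule.mem_top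
    obtain ⟨s, hs, t, ht, rfl⟩ := Submodule.mem_sup.1 hv
    have e1 : ∀ x ∈ S.toSubmodule, Submodule.projection S.toSubmodule T.toSubmodule hc x = x :=
      fun x hx => Submodule.projection_apply_left hc ⟨x, hx⟩
    have e2 : ∀ x ∈ T.toSubmodule, Submodule.projection S.toSubmodule T.toSubmodule hc x = 0 :=
      fun x hx => Submodule.projection_apply_right hc ⟨x, hx⟩
    rw [map_add, map_add, map_add, e1 _ hs, e2 _ ht, e1 _ (S.apply_mem_toSubmodule g hs),
      e2 _ (T.apply_mem_toSubmodule g ht), add_zero, add_zero]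
  obtain ⟨c, hcp⟩ := (finrank_eq_one_iff_of_nonzero' (IntertwiningMap.id ρ) hid).1 h
    (LinearMap.intertwiningMap_of_isIntertwiningMap ρ ρ (Submodule.projection S.toSubmodule T.toSubmodule hc) hint)
  have hcv : ∀ v, c • v = Submodule.projection S.toSubmodule T.toSubmodule hc v := fun v =>
    congrArg (fun f : IntertwiningMap ρ ρ => f v) hcp
  by_cases h0 : c = 0
  · left
    apply Subrepresentation.toSubmodule_injective
    change S.toSubmodule = ⊥
    rw [Submodule.eq_bot_iff]
    intro x hx
    have := hcv x
    rw [h0, zero_smul] at this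
    rw [this]
    exact (Submodule.projection_apply_left hc ⟨x, hx⟩).symm
  · right
    apply Subrepresentation.toSubmodule_injective
    change S.toSubmodule = ⊤
    rw [Submodule.eq_top_iff']
    intro x
    have : c • x ∈ S.toSubmodule := by
      rw [hcv]; exact Submodule.projection_apply_mem hc x
    simpa [smul_smul, h0] using S.toSubmodule.smul_mem c⁻¹ this

theorem sum_char_mul_char_inv (ρ : Representation ℂ G V) (σ : Representation ℂ G W) :
    ∑ g : G, σ.character g * ρ.character g⁻¹ =
      (Module.finrank ℂ (IntertwiningMap ρ σ) : ℂ) * Fintype.card G := by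
  have : Invertible (Nat.card G : ℂ) := invertibleOfNonzero (by simp [Nat.card_eq_fintype_card])
  rw [← card_inv_mul_sum_char_mul_char_eq_finrank, Nat.card_eq_fintype_card]
  field_simp

theorem isIrreducible_of_sum_char (ρ : Representation ℂ G V)
    (h : ∑ g : G, ρ.character g * ρ.character g⁻¹ = Fintype.card G) : ρ.IsIrreducible := by
  apply isIrreducible_of_finrank_intertwiningMap_eq_one
  rw [sum_char_mul_char_inv] at h
  have hG : (Fintype.card G : ℂ) ≠ 0 := by simp
  exact_mod_cast mul_right_cancel₀ hG (h.trans (one_mul _).symm)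

omit [Fintype G] in
theorem one_le_finrank_intertwiningMap_self [Nontrivial V] (ρ : Representation ℂ G V) :
    1 ≤ Module.finrank ℂ (IntertwiningMap ρ ρ) := by
  have hid : IntertwiningMap.id ρ ≠ 0 := by
    intro h0
    obtain ⟨v, hv⟩ := exists_ne (0 : V)
    apply hv
    have := congrArg (fun f : IntertwiningMap ρ ρ => f v) h0
    simpa using this
  have : Nontrivial (IntertwiningMap ρ ρ) := ⟨_, _, hid⟩
  have : Module.Finite ℂ (IntertwiningMap ρ ρ) :=
    Module.Finite.equiv (invariantsEquivIntertwiningMap ρ ρ)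
  exact Module.finrank_pos

omit [Fintype G] [FiniteDimensional ℂ V] [FiniteDimensional ℂ W] in
/-- An injective equivariant map from a nonzero representation to an irreducible one is an
isomorphism. -/
theorem character_eq_of_injective [Nontrivial V] {ρ : Representation ℂ G V}
    {σ : Representation ℂ G W} (hσ : σ.IsIrreducible) (f : IntertwiningMap ρ σ)
    (hf : Function.Injective f) : ρ.character = σ.character := by
  have h0 : f ≠ 0 := by
    intro h0
    obtain ⟨v, hv⟩ := exists_ne (0 : V)
    apply hv
    apply hf
    rw [map_zero, h0]
    rfl
  exact char_iso (f.ofBijective ⟨hf, (IsIrreducible.surjective_or_eq_zero f).resolve_right h0⟩)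

end General

/-! ### Traces and fixed points -/

theorem trace_eq_of_comm {V W : Type*} [AddCommGroup V] [Module ℂ V] [AddCommGroup W] [Module ℂ W]
    {e : V →ₗ[ℂ] W} (he : Function.Bijective e) (f : V →ₗ[ℂ] V) (g : W →ₗ[ℂ] W)
    (h : ∀ v, e (f v) = g (e v)) : LinearMap.trace ℂ V f = LinearMap.trace ℂ W g := by
  have : (LinearEquiv.ofBijective e he).conj f = g := by
    ext w
    rw [LinearEquiv.conj_apply_apply, LinearEquiv.ofBijective_apply, h,
      ← LinearEquiv.ofBijective_apply e (hf := he), LinearEquiv.apply_symm_apply]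
  rw [← this, LinearMap.trace_conj']

theorem trace_funLeft {Y : Type*} [Fintype Y] [DecidableEq Y] (m : Y → Y) :
    LinearMap.trace ℂ (Y → ℂ) (LinearMap.funLeft ℂ ℂ m) =
      ((Finset.univ.filter fun y => m y = y).card : ℂ) := by
  rw [LinearMap.trace_eq_matrix_trace ℂ (Pi.basisFun ℂ Y), Matrix.trace]
  simp [LinearMap.funLeft_apply, Pi.single_apply]

/-- The number of fixed points of a permutation. -/
def fixCount {n : ℕ} (σ : Perm (Fin n)) : ℕ := (Finset.univ.filter fun i => σ i = i).card

theorem fixCount_inv {n : ℕ} (σ : Perm (Fin n)) : fixCount σ⁻¹ = fixCount σ := by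
  unfold fixCount
  congr 1
  ext i
  simp only [Finset.mem_filter, Finset.mem_univ, true_and]
  rw [Perm.inv_eq_iff_eq, eq_comm]

theorem defRep_character {n : ℕ} (σ : Perm (Fin n)) : (defRep n).character σ = fixCount σ := by
  rw [← fixCount_inv]
  unfold Representation.character
  rw [trace_eq_of_comm ((MonoidAlgebra.coeffLinearEquiv ℂ).trans
    (Finsupp.linearEquivFunOnFinite ℂ ℂ (Fin n))).bijective _ (LinearMap.funLeft ℂ ℂ (σ⁻¹ : Perm (Fin n)))]
  · rw [trace_funLeft]; rfl
  · intro v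
    ext i
    simp [defRep, coeff_ofMulAction, LinearMap.funLeft_apply]

/-! ### Function models of the constituents -/

/-- The representation of `Sₙ` on functions on the letters. -/
def permRep (n : ℕ) : Representation ℂ (Perm (Fin n)) (Fin n → ℂ) where
  toFun σ := LinearMap.funLeft ℂ ℂ ⇑σ⁻¹
  map_one' := rfl
  map_mul' _ _ := rfl

theorem permRep_apply {n : ℕ} (σ : Perm (Fin n)) (f : Fin n → ℂ) (i : Fin n) :
    permRep n σ f i = f (σ⁻¹ i) := rfl

/-- The representation of `Sₙ` on functions on pairs of letters. -/
def pairRep (n : ℕ) : Representation ℂ (Perm (Fin n)) (Fin n × Fin n → ℂ) where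
  toFun σ := LinearMap.funLeft ℂ ℂ (Prod.map ⇑σ⁻¹ ⇑σ⁻¹)
  map_one' := rfl
  map_mul' _ _ := rfl

theorem pairRep_apply {n : ℕ} (σ : Perm (Fin n)) (f : Fin n × Fin n → ℂ) (i j : Fin n) :
    pairRep n σ f (i, j) = f (σ⁻¹ i, σ⁻¹ j) := rfl

/-- Functions on the letters with sum zero. -/
def sumZero (n : ℕ) : Subrepresentation (permRep n) where
  toSubmodule :=
    { carrier := {f | ∑ i, f i = 0}
      zero_mem' := by simp
      add_mem' := fun {f g} hf hg => by
        simp only [Set.mem_ofPred_eq] at *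
        simp [Finset.sum_add_distrib, hf, hg]
      smul_mem' := fun c f hf => by
        simp only [Set.mem_ofPred_eq] at *
        simp [← Finset.mul_sum, hf] }
  apply_mem_toSubmodule σ f hf := by
    change ∑ i, f (σ⁻¹ i) = 0
    rw [Equiv.sum_comp σ⁻¹ f]
    exact hf

theorem mem_sumZero {n : ℕ} {f : Fin n → ℂ} :
    f ∈ (sumZero n).toSubmodule ↔ ∑ i, f i = 0 := Iff.rfl

/-- Symmetric functions on pairs that vanish on the diagonal and have all row sums zero. -/
def symZero (n : ℕ) : Subrepresentation (pairRep n) where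
  toSubmodule :=
    { carrier := {f | (∀ i j, f (i, j) = f (j, i)) ∧ (∀ i, f (i, i) = 0) ∧ ∀ i, ∑ j, f (i, j) = 0}
      zero_mem' := by simp
      add_mem' := fun {f g} hf hg => by
        simp only [Set.mem_ofPred_eq] at *
        refine ⟨fun i j => ?_, fun i => ?_, fun i => ?_⟩
        · simp [hf.1 i j, hg.1 i j]
        · simp [hf.2.1, hg.2.1]
        · simp [Finset.sum_add_distrib, hf.2.2, hg.2.2]
      smul_mem' := fun c f hf => by
        simp only [Set.mem_ofPred_eq] at *
        refine ⟨fun i j => ?_, fun i => ?_, fun i => ?_⟩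
        · simp [hf.1 i j]
        · simp [hf.2.1]
        · simp [← Finset.mul_sum, hf.2.2] }
  apply_mem_toSubmodule σ f hf := by
    refine ⟨fun i j => hf.1 _ _, fun i => hf.2.1 _, fun i => ?_⟩
    change ∑ j, f (σ⁻¹ i, σ⁻¹ j) = 0
    rw [Equiv.sum_comp σ⁻¹ fun j => f (σ⁻¹ i, j)]
    exact hf.2.2 _

theorem mem_symZero {n : ℕ} {f : Fin n × Fin n → ℂ} : f ∈ (symZero n).toSubmodule ↔
    (∀ i j, f (i, j) = f (j, i)) ∧ (∀ i, f (i, i) = 0) ∧ ∀ i, ∑ j, f (i, j) = 0 := Iff.rfl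

/-- Antisymmetric functions on pairs with all row sums zero. -/
def altZero (n : ℕ) : Subrepresentation (pairRep n) where
  toSubmodule :=
    { carrier := {f | (∀ i j, f (i, j) = -f (j, i)) ∧ ∀ i, ∑ j, f (i, j) = 0}
      zero_mem' := by simp
      add_mem' := fun {f g} hf hg => by
        simp only [Set.mem_ofPred_eq] at *
        refine ⟨fun i j => ?_, fun i => ?_⟩
        · simp [hf.1 i j, hg.1 i j]; ring
        · simp [Finset.sum_add_distrib, hf.2, hg.2]
      smul_mem' := fun c f hf => by
        simp only [Set.mem_ofPred_eq] at *
        refine ⟨fun i j => ?_, fun i => ?_⟩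
        · simp [hf.1 i j]
        · simp [← Finset.mul_sum, hf.2] }
  apply_mem_toSubmodule σ f hf := by
    refine ⟨fun i j => hf.1 _ _, fun i => ?_⟩
    change ∑ j, f (σ⁻¹ i, σ⁻¹ j) = 0
    rw [Equiv.sum_comp σ⁻¹ fun j => f (σ⁻¹ i, j)]
    exact hf.2 _

theorem mem_altZero {n : ℕ} {f : Fin n × Fin n → ℂ} : f ∈ (altZero n).toSubmodule ↔
    (∀ i j, f (i, j) = -f (j, i)) ∧ ∀ i, ∑ j, f (i, j) = 0 := Iff.rfl

/-! ### Decomposing functions on letters and on pairs -/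

/-- The decomposition of functions on the letters into constants and `sumZero`. -/
def lettersAssemble (n : ℕ) : ℂ × (sumZero n).toSubmodule →ₗ[ℂ] (Fin n → ℂ) where
  toFun x i := x.1 + x.2.1 i
  map_add' x y := by ext i; simp; ring
  map_smul' c x := by ext i; simp; ring

theorem lettersAssemble_bijective {n : ℕ} (hn : 0 < n) :
    Function.Bijective (lettersAssemble n) := by
  have hn' : (n : ℂ) ≠ 0 := by exact_mod_cast hn.ne'
  constructor
  · rw [injective_iff_map_eq_zero]
    rintro ⟨c, v, hv⟩ h
    rw [mem_sumZero] at hv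
    have h' : ∀ i, c + v i = 0 := fun i => congrFun h i
    have hc : c = 0 := by
      have : ∑ i, (c + v i) = 0 := Finset.sum_eq_zero fun i _ => h' i
      rw [Finset.sum_add_distrib, hv] at this
      simpa [hn.ne'] using this
    subst hc
    have : v = 0 := by ext i; simpa using h' i
    subst this
    rfl
  · intro f
    refine ⟨((∑ i, f i) / n, ⟨fun i => f i - (∑ i, f i) / n, ?_⟩), ?_⟩
    · rw [mem_sumZero, Finset.sum_sub_distrib]
      simp; field_simp; simp
    · ext i
      simp [lettersAssemble]

theorem character_sumZero {n : ℕ} (hn : 0 < n) (σ : Perm (Fin n)) :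
    (sumZero n).toRepresentation.character σ = fixCount σ - 1 := by
  have h := trace_eq_of_comm (lettersAssemble_bijective hn)
    (LinearMap.prodMap LinearMap.id ((sumZero n).toRepresentation σ)) (permRep n σ)
    (fun v => rfl)
  rw [LinearMap.trace_prodMap'] at h
  have h2 : LinearMap.trace ℂ _ (permRep n σ) = (fixCount σ : ℂ) := by
    rw [← fixCount_inv]; exact trace_funLeft _
  rw [h2] at h
  rw [← h]
  simp [Representation.character]

/-- The decomposition of functions on pairs into copies of functions on the letters and the
spaces `sumZero`, `symZero`, `altZero`. -/
def pairsAssemble (n : ℕ) : (Fin n → ℂ) × (sumZero n).toSubmodule × (Fin n → ℂ) ×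
    (symZero n).toSubmodule × (altZero n).toSubmodule →ₗ[ℂ] (Fin n × Fin n → ℂ) where
  toFun x a := x.1 a.1 + x.1 a.2 + (x.2.1.1 a.1 - x.2.1.1 a.2) +
    (if a.1 = a.2 then x.2.2.1 a.1 else 0) + x.2.2.2.1.1 a + x.2.2.2.2.1 a
  map_add' x y := by ext a; simp; split_ifs <;> ring
  map_smul' c x := by ext a; simp; split_ifs <;> ring

theorem pairsAssemble_apply {n : ℕ} (p : Fin n → ℂ) (v : (sumZero n).toSubmodule) (d : Fin n → ℂ)
    (s : (symZero n).toSubmodule) (t : (altZero n).toSubmodule) (i j : Fin n) :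
    pairsAssemble n (p, v, d, s, t) (i, j) = p i + p j + (v.1 i - v.1 j) +
      (if i = j then d i else 0) + s.1 (i, j) + t.1 (i, j) := rfl

/-- Antisymmetrizing isolates `v` and `t`, and the row sums of that part give `n * v i = 0`. In the
symmetric part the diagonal gives `d = -2p`, the row sums give `(n - 2) * p i + ∑ p = 0`, and
summing over `i` gives `(2n - 2) * ∑ p = 0`. -/
theorem pairsAssemble_injective {n : ℕ} (hn : 3 ≤ n) :
    Function.Injective (pairsAssemble n) := by
  -- With `n = m + 3`, the divisors `n`, `n - 2` and `2n - 2` become `m + 3`, `m + 1` and `2m + 4`,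
  -- all visibly nonzero.
  obtain ⟨m, rfl⟩ := Nat.exists_eq_add_of_le' hn
  have h1 : ((m + 3 : ℕ) : ℂ) ≠ 0 := by norm_cast
  have h2 : (m : ℂ) + 1 ≠ 0 := by norm_cast
  have h3 : 2 * (m : ℂ) + 4 ≠ 0 := by norm_cast
  rw [injective_iff_map_eq_zero]
  rintro ⟨p, ⟨v, hv⟩, d, ⟨s, hs⟩, ⟨t, ht⟩⟩ h
  rw [mem_sumZero] at hv
  rw [mem_symZero] at hs
  rw [mem_altZero] at ht
  have e : ∀ i j, p i + p j + (v i - v j) + (if i = j then d i else 0) + s (i, j) + t (i, j) = 0 :=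
    fun i j => by rw [← pairsAssemble_apply p ⟨v, hv⟩ d ⟨s, hs⟩ ⟨t, ht⟩, h]; rfl
  have ea : ∀ i j, v i - v j + t (i, j) = 0 := by
    intro i j
    have a := e i j
    have b := e j i
    rw [hs.1 j i, ht.1 j i] at b
    by_cases hij : i = j
    · subst hij
      have := ht.1 i i
      simp only [sub_self, zero_add]
      linear_combination this / 2
    · simp only [hij, Ne.symm hij, if_false] at a b
      linear_combination (a - b) / 2
  have ev : v = 0 := by
    ext i
    have : ∑ j, (v i - v j + t (i, j)) = 0 := Finset.sum_eq_zero fun j _ => ea i j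
    rw [Finset.sum_add_distrib, Finset.sum_sub_distrib, hv, ht.2] at this
    simp only [Finset.sum_const, Finset.card_univ, Fintype.card_fin, nsmul_eq_mul, sub_zero,
      add_zero, mul_eq_zero] at this
    exact this.resolve_left h1
  subst ev
  have et : t = 0 := by
    ext ⟨i, j⟩
    simpa using ea i j
  subst et
  simp only [Pi.zero_apply, sub_self, add_zero] at e
  have ed : ∀ i, d i = -2 * p i := by
    intro i
    have := e i i
    simp only [if_true, hs.2.1] at this
    linear_combination this
  have er : ∀ i, ((m : ℂ) + 1) * p i + ∑ j, p j = 0 := by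
    intro i
    have : ∑ j, (p i + p j + (if i = j then d i else 0) + s (i, j)) = 0 :=
      Finset.sum_eq_zero fun j _ => e i j
    simp only [Finset.sum_add_distrib, hs.2.2, Finset.sum_ite_eq, Finset.mem_univ, if_true,
      Finset.sum_const, Finset.card_univ, Fintype.card_fin, nsmul_eq_mul] at this
    rw [ed] at this
    push_cast at this
    linear_combination this
  have eP : ∑ j, p j = 0 := by
    have : ∑ i, (((m : ℂ) + 1) * p i + ∑ j, p j) = 0 := Finset.sum_eq_zero fun i _ => er i
    rw [Finset.sum_add_distrib, ← Finset.mul_sum] at this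
    simp only [Finset.sum_const, Finset.card_univ, Fintype.card_fin, nsmul_eq_mul] at this
    push_cast at this
    have h' : (2 * (m : ℂ) + 4) * ∑ j, p j = 0 := by linear_combination this
    exact (mul_eq_zero.1 h').resolve_left h3
  have ep : p = 0 := by
    ext i
    have := er i
    rw [eP, add_zero] at this
    exact (mul_eq_zero.1 this).resolve_left h2
  subst ep
  have ed' : d = 0 := by ext i; simp [ed]
  subst ed'
  have es : s = 0 := by
    ext ⟨i, j⟩
    simpa using e i j
  subst es
  rfl

/-- The equations used for injectivity are solved explicitly, starting from the symmetric part `S`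
and the antisymmetric part `A` of the target. -/
theorem pairsAssemble_surjective {n : ℕ} (hn : 3 ≤ n) :
    Function.Surjective (pairsAssemble n) := by
  obtain ⟨m, rfl⟩ := Nat.exists_eq_add_of_le' hn
  have h1 : (m : ℂ) + 3 ≠ 0 := by norm_cast
  have h2 : (m : ℂ) + 1 ≠ 0 := by norm_cast
  have h3 : 2 * (m : ℂ) + 4 ≠ 0 := by norm_cast
  intro f
  set S : Fin (m + 3) × Fin (m + 3) → ℂ := fun a => (f a + f a.swap) / 2 with hS
  set A : Fin (m + 3) × Fin (m + 3) → ℂ := fun a => (f a - f a.swap) / 2 with hA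
  have hSs : ∀ i j, S (i, j) = S (j, i) := fun i j => by simp [hS]; ring
  have hAs : ∀ i j, A (i, j) = -A (j, i) := fun i j => by simp [hA]; ring
  set v : Fin (m + 3) → ℂ := fun i => (∑ j, A (i, j)) / ((m : ℂ) + 3) with hv
  have hvs : ∑ i, v i = 0 := by
    have : ∑ i, ∑ j, A (i, j) = 0 := by
      have h := Finset.sum_comm (s := Finset.univ) (t := Finset.univ) (f := fun i j => A (i, j))
      have h' : ∑ y, ∑ x, A (x, y) = -∑ y, ∑ x, A (y, x) := by
        simp only [← Finset.sum_neg_distrib]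
        exact Finset.sum_congr rfl fun y _ => Finset.sum_congr rfl fun x _ => hAs x y
      rw [h'] at h
      exact self_eq_neg.1 h
    rw [hv, ← Finset.sum_div, this, zero_div]
  -- `R i` is the off-diagonal row sum of `S`. Zero row sums for the remainder require `(n - 2) * p
  -- i + P = R i` with `P = ∑ p`; summing over `i` forces `P = ∑ R / (2n - 2)`.
  set R : Fin (m + 3) → ℂ := fun i => ∑ j, S (i, j) - S (i, i) with hR
  set P : ℂ := (∑ i, R i) / (2 * (m : ℂ) + 4) with hP
  set p : Fin (m + 3) → ℂ := fun i => (R i - P) / ((m : ℂ) + 1) with hp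
  have hps : ∑ i, p i = P := by
    rw [hp, ← Finset.sum_div, Finset.sum_sub_distrib]
    simp only [Finset.sum_const, Finset.card_univ, Fintype.card_fin, nsmul_eq_mul]
    have : ∑ i, R i = (2 * (m : ℂ) + 4) * P := by rw [hP]; field_simp
    rw [this]
    push_cast
    field_simp
    ring
  refine ⟨(p, ⟨v, hvs⟩, fun i => S (i, i) - 2 * p i,
    ⟨fun a => if a.1 = a.2 then 0 else S a - p a.1 - p a.2, ?_⟩,
    ⟨fun a => A a - (v a.1 - v a.2), ?_⟩), ?_⟩
  · rw [mem_symZero]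
    refine ⟨fun i j => ?_, fun i => by simp, fun i => ?_⟩
    · by_cases hij : i = j
      · subst hij; rfl
      · simp only [hij, Ne.symm hij, if_false]
        rw [hSs]; ring
    · have : ∀ j, (if i = j then 0 else S (i, j) - p i - p j) =
          S (i, j) - p i - p j - if i = j then S (i, i) - 2 * p i else 0 := by
        intro j
        split_ifs with hij
        · subst hij; ring
        · ring
      simp only [this, Finset.sum_sub_distrib, Finset.sum_ite_eq, Finset.mem_univ, if_true, hps,
        Finset.sum_const, Finset.card_univ, Fintype.card_fin, nsmul_eq_mul]
      have hpi : ((m : ℂ) + 1) * p i = R i - P := by simp only [hp]; field_simp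
      have hRi : R i = ∑ j, S (i, j) - S (i, i) := rfl
      push_cast
      linear_combination -hpi - hRi
  · rw [mem_altZero]
    refine ⟨fun i j => ?_, fun i => ?_⟩
    · simp only
      rw [hAs]; ring
    · simp only [Finset.sum_sub_distrib, hvs, Finset.sum_const, Finset.card_univ,
        Fintype.card_fin, nsmul_eq_mul]
      simp only [hv]
      push_cast
      field_simp
      ring
  · ext ⟨i, j⟩
    rw [pairsAssemble_apply]
    have hf : f (i, j) = S (i, j) + A (i, j) := by simp only [hS, hA]; ring
    rw [hf]
    by_cases hij : i = j
    · subst hij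
      simp only [if_true]
      ring
    · simp only [hij, if_false]
      ring

theorem pairsAssemble_bijective {n : ℕ} (hn : 3 ≤ n) : Function.Bijective (pairsAssemble n) :=
  ⟨pairsAssemble_injective hn, pairsAssemble_surjective hn⟩

/-! ### Characters of the constituents -/

theorem fixCount_sq {n : ℕ} (hn : 3 ≤ n) (σ : Perm (Fin n)) :
    (fixCount σ : ℂ) ^ 2 = 2 * fixCount σ + (sumZero n).toRepresentation.character σ +
      (symZero n).toRepresentation.character σ + (altZero n).toRepresentation.character σ := by
  have h := trace_eq_of_comm (pairsAssemble_bijective hn)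
    ((permRep n σ).prodMap (((sumZero n).toRepresentation σ).prodMap ((permRep n σ).prodMap
      (((symZero n).toRepresentation σ).prodMap ((altZero n).toRepresentation σ)))))
    (pairRep n σ) (by
      rintro ⟨p, v, d, s, t⟩
      ext ⟨i, j⟩
      simp only [LinearMap.prodMap_apply, pairRep_apply,
        pairsAssemble_apply, permRep_apply, EmbeddingLike.apply_eq_iff_eq]
      rfl)
  simp only [LinearMap.trace_prodMap'] at h
  have h2 : LinearMap.trace ℂ _ (permRep n σ) = (fixCount σ : ℂ) := by
    rw [← fixCount_inv]; exact trace_funLeft _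
  have h3 : LinearMap.trace ℂ _ (pairRep n σ) = (fixCount σ : ℂ) ^ 2 := by
    rw [← fixCount_inv]
    refine (trace_funLeft _).trans ?_
    rw [fixCount, ← Nat.cast_pow, sq, ← Finset.card_product]
    congr 2
    ext ⟨i, j⟩
    simp
  rw [h2, h3] at h
  rw [← h]
  simp only [Representation.character]
  ring

/-- Compose the action on pairs with the exchange of coordinates: symmetric blocks keep their trace
and antisymmetric blocks change sign. The pairs fixed by the composite are the `(i, σ i)` with `σ (σ
i) = i`. Together with `fixCount_sq` this separates the characters of `symZero` and `altZero`. -/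
theorem fixCount_mul_self {n : ℕ} (hn : 3 ≤ n) (σ : Perm (Fin n)) :
    (fixCount (σ * σ) : ℂ) = 2 * fixCount σ - (sumZero n).toRepresentation.character σ +
      (symZero n).toRepresentation.character σ - (altZero n).toRepresentation.character σ := by
  have h := trace_eq_of_comm (pairsAssemble_bijective hn)
    ((permRep n σ).prodMap (((-1 : ℂ) • (sumZero n).toRepresentation σ).prodMap ((permRep n σ).prodMap
      (((symZero n).toRepresentation σ).prodMap ((-1 : ℂ) • (altZero n).toRepresentation σ)))))
    (LinearMap.funLeft ℂ ℂ fun a : Fin n × Fin n => (σ⁻¹ a.2, σ⁻¹ a.1)) (by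
      rintro ⟨p, v, d, ⟨s, hs⟩, ⟨t, ht⟩⟩
      rw [mem_symZero] at hs
      rw [mem_altZero] at ht
      ext ⟨i, j⟩
      simp only [LinearMap.prodMap_apply, LinearMap.funLeft_apply,
        pairsAssemble_apply, permRep_apply, EmbeddingLike.apply_eq_iff_eq]
      have e1 : (((-1 : ℂ) • (sumZero n).toRepresentation σ) v).1 = fun i => -1 * v.1 (σ⁻¹ i) := rfl
      have e2 : ((symZero n).toRepresentation σ ⟨s, hs⟩).1 (i, j) = s (σ⁻¹ i, σ⁻¹ j) := rfl
      have e3 : (((-1 : ℂ) • (altZero n).toRepresentation σ) ⟨t, ht⟩).1 (i, j) =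
        -1 * t (σ⁻¹ i, σ⁻¹ j) := rfl
      rw [e1, e2, e3, hs.1, ht.1 (σ⁻¹ i)]
      by_cases hij : i = j
      · subst hij; simp only [if_true]; ring
      · simp only [hij, Ne.symm hij, if_false]; ring)
  simp only [LinearMap.trace_prodMap'] at h
  have h2 : LinearMap.trace ℂ _ (permRep n σ) = (fixCount σ : ℂ) := by
    rw [← fixCount_inv]; exact trace_funLeft _
  rw [h2, trace_funLeft] at h
  have h3 : (Finset.univ.filter fun a : Fin n × Fin n => (σ⁻¹ a.2, σ⁻¹ a.1) = a).card =
      fixCount (σ * σ) := by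
    symm
    refine Finset.card_bij (fun i _ => (i, σ i)) ?_ ?_ ?_
    · intro i hi
      have hi' : σ (σ i) = i := (Finset.mem_filter.1 hi).2
      simp only [Finset.mem_filter, Finset.mem_univ, true_and]
      ext1
      · simp
      · change σ⁻¹ i = σ i
        rw [Perm.inv_eq_iff_eq, hi']
    · intro a _ b _ hab
      exact congrArg Prod.fst hab
    · rintro ⟨i, j⟩ h
      simp only [Finset.mem_filter, Finset.mem_univ, true_and, Prod.mk.injEq,
        Perm.inv_eq_iff_eq] at h
      refine ⟨i, Finset.mem_filter.2 ⟨Finset.mem_univ _, ?_⟩, by rw [h.1]⟩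
      rw [Perm.mul_apply, ← h.1, ← h.2]
  rw [h3] at h
  rw [← h]
  simp only [Representation.character]
  rw [map_smul, map_smul]
  simp only [smul_eq_mul]
  ring

theorem character_symZero {n : ℕ} (hn : 3 ≤ n) (σ : Perm (Fin n)) :
    2 * (symZero n).toRepresentation.character σ =
      (fixCount σ : ℂ) ^ 2 + fixCount (σ * σ) - 4 * fixCount σ := by
  rw [fixCount_sq hn, fixCount_mul_self hn]
  ring

theorem character_altZero {n : ℕ} (hn : 3 ≤ n) (σ : Perm (Fin n)) :
    2 * (altZero n).toRepresentation.character σ =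
      (fixCount σ : ℂ) ^ 2 - fixCount (σ * σ) - 2 * fixCount σ + 2 := by
  have h := character_sumZero (by omega : 0 < n) σ
  rw [fixCount_sq hn, fixCount_mul_self hn]
  linear_combination -2 * h

theorem fixCount_one (n : ℕ) : fixCount (1 : Perm (Fin n)) = n := by simp [fixCount]

theorem nontrivial_sumZero {n : ℕ} (hn : 2 ≤ n) : Nontrivial (sumZero n).toSubmodule := by
  apply Module.nontrivial_of_finrank_pos (R := ℂ)
  have h := character_sumZero (by omega : 0 < n) 1
  rw [char_one, fixCount_one, ← Nat.cast_one, ← Nat.cast_sub (by omega)] at h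
  rw [Nat.cast_injective h]
  omega

/-- The character at 1 gives dimension `n(n-3)/2`, which vanishes at `n = 3` and is positive from `n
= 4` on. -/
theorem nontrivial_symZero {n : ℕ} (hn : 4 ≤ n) : Nontrivial (symZero n).toSubmodule := by
  apply Module.nontrivial_of_finrank_pos (R := ℂ)
  have h := character_symZero (by omega : 3 ≤ n) 1
  rw [char_one, mul_one, fixCount_one] at h
  have h' : 2 * Module.finrank ℂ (symZero n).toSubmodule + 3 * n = n ^ 2 := by
    have : (2 * Module.finrank ℂ (symZero n).toSubmodule + 3 * n : ℂ) = n ^ 2 := by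
      linear_combination h
    exact_mod_cast this
  nlinarith

theorem nontrivial_altZero {n : ℕ} (hn : 3 ≤ n) : Nontrivial (altZero n).toSubmodule := by
  apply Module.nontrivial_of_finrank_pos (R := ℂ)
  have h := character_altZero hn 1
  rw [char_one, mul_one, fixCount_one] at h
  have h' : 2 * Module.finrank ℂ (altZero n).toSubmodule + 3 * n = n ^ 2 + 2 := by
    have : (2 * Module.finrank ℂ (altZero n).toSubmodule + 3 * n : ℂ) = n ^ 2 + 2 := by
      linear_combination h
    exact_mod_cast this
  nlinarith

/-! ### The fourth moment of the fixed-point count -/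

/-- The first position at which the value `x i` occurs. -/
def firstOccurrence {n : ℕ} (x : Fin 4 → Fin n) (i : Fin 4) : Fin 4 :=
  (Finset.univ.filter fun j => x j = x i).min' ⟨i, by simp⟩

theorem apply_firstOccurrence {n : ℕ} (x : Fin 4 → Fin n) (i : Fin 4) :
    x (firstOccurrence x i) = x i :=
  (Finset.mem_filter.1 (Finset.min'_mem (Finset.univ.filter fun j => x j = x i) ⟨i, by simp⟩)).2

theorem firstOccurrence_congr {n : ℕ} {x y : Fin 4 → Fin n} {i j : Fin 4}
    (h : ∀ k, x k = x i ↔ y k = y j) : firstOccurrence x i = firstOccurrence y j := by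
  unfold firstOccurrence
  congr 1
  ext k
  simp [h]

theorem firstOccurrence_le {n : ℕ} (x : Fin 4 → Fin n) (i : Fin 4) : firstOccurrence x i ≤ i :=
  Finset.min'_le _ _ (by simp)

/-- Such maps send each index to the least element of its block, so they correspond to the set
partitions of four points. -/
theorem card_patterns : Fintype.card
    {f : Fin 4 → Fin 4 // ∀ i, f i ≤ i ∧ f (f i) = f i} = 15 := by
  decide +kernel

section Transitive

variable {G : Type*} [Group G] [Fintype G] {n : ℕ}

/-- The group acts transitively on quadruples of letters with a given pattern of equalities. -/
def PatternTransitive (φ : G →* Perm (Fin n)) : Prop :=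
  ∀ x y : Fin 4 → Fin n, (∀ i j, x i = x j ↔ y i = y j) → ∃ g, ∀ i, φ g (x i) = y i

/-- Burnside's lemma on quadruples: an element fixes `fixCount ^ 4` of them, and `N` is the number
of orbits. By transitivity an orbit is determined by its equality pattern. -/
theorem sum_fixCount_pow_four (φ : G →* Perm (Fin n)) (hφ : PatternTransitive φ) :
    ∃ N ≤ 15, ∑ g, fixCount (φ g) ^ 4 = N * Fintype.card G := by
  classical
  let _ : MulAction G (Fin 4 → Fin n) :=
    { smul := fun g x i => φ g (x i)
      one_smul := fun x => by
        funext i; change φ 1 (x i) = x i; rw [map_one]; rfl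
      mul_smul := fun g h x => by
        funext i; change φ (g * h) (x i) = φ g (φ h (x i)); rw [map_mul]; rfl }
  have hsmul : ∀ (g : G) (x : Fin 4 → Fin n) (i : Fin 4), (g • x) i = φ g (x i) :=
    fun _ _ _ => rfl
  let _ : Fintype (Quotient (MulAction.orbitRel G (Fin 4 → Fin n))) := Fintype.ofFinite _
  refine ⟨Fintype.card (Quotient (MulAction.orbitRel G (Fin 4 → Fin n))), ?_, ?_⟩
  · rw [← card_patterns]
    refine Fintype.card_le_of_injective
      (fun q => ⟨firstOccurrence q.out, fun i => ⟨firstOccurrence_le _ i, ?_⟩⟩) ?_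
    · exact firstOccurrence_congr (j := i) fun k => by rw [apply_firstOccurrence q.out i]
    · intro q r hqr
      have h : firstOccurrence q.out = firstOccurrence r.out := congrArg Subtype.val hqr
      -- First occurrences recover the pattern: two entries agree exactly when their first
      -- occurrences do.
      have key : ∀ x y : Fin 4 → Fin n, firstOccurrence x = firstOccurrence y →
          ∀ i j, x i = x j → y i = y j := by
        intro x y hxy i j hij
        rw [← apply_firstOccurrence y i, ← apply_firstOccurrence y j, ← hxy,
          firstOccurrence_congr (i := i) (j := j) fun k => by rw [hij]]
      obtain ⟨g, hg⟩ := hφ r.out q.out fun i j => ⟨key _ _ h.symm i j, key _ _ h i j⟩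
      rw [← q.out_eq, ← r.out_eq]
      exact Quotient.sound ⟨g, funext hg⟩
  · rw [← MulAction.sum_card_fixedBy_eq_card_orbits_mul_card_group]
    refine Finset.sum_congr rfl fun g _ => ?_
    have e : fixCount (φ g) = Fintype.card {i // φ g i = i} := by
      rw [fixCount, Fintype.card_subtype]
    have e4 : fixCount (φ g) ^ 4 = Fintype.card (Fin 4 → {i // φ g i = i}) := by
      rw [e]; simp
    rw [e4]
    refine Fintype.card_congr
      { toFun := fun x => ⟨fun i => (x i).1, funext fun i => (x i).2⟩
        invFun := fun x i => ⟨x.1 i, congrFun x.2 i⟩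
        left_inv := fun x => rfl
        right_inv := fun x => rfl }

theorem sum_char_of_patternTransitive (hn : 4 ≤ n) (φ : G →* Perm (Fin n))
    (hφ : PatternTransitive φ) :
    (∑ g, (sumZero n).toRepresentation.character (φ g) *
        (sumZero n).toRepresentation.character (φ g)⁻¹ = Fintype.card G) ∧
      (∑ g, (symZero n).toRepresentation.character (φ g) *
        (symZero n).toRepresentation.character (φ g)⁻¹ = Fintype.card G) ∧
      ∑ g, (altZero n).toRepresentation.character (φ g) *
        (altZero n).toRepresentation.character (φ g)⁻¹ = Fintype.card G := by
  have := nontrivial_sumZero (by omega : 2 ≤ n)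
  have := nontrivial_symZero hn
  have := nontrivial_altZero (by omega : 3 ≤ n)
  obtain ⟨N, hN, hsum⟩ := sum_fixCount_pow_four φ hφ
  let ρ₀ : Representation ℂ G ℂ := Representation.trivial ℂ G ℂ
  let ρ₁ : Representation ℂ G (sumZero n).toSubmodule := (sumZero n).toRepresentation.comp φ
  let ρ₂ : Representation ℂ G (symZero n).toSubmodule := (symZero n).toRepresentation.comp φ
  let ρ₃ : Representation ℂ G (altZero n).toSubmodule := (altZero n).toRepresentation.comp φ
  have h0 := one_le_finrank_intertwiningMap_self ρ₀
  have h1 := one_le_finrank_intertwiningMap_self ρ₁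
  have h2 := one_le_finrank_intertwiningMap_self ρ₂
  have h3 := one_le_finrank_intertwiningMap_self ρ₃
  have hfix : ∀ g, (fixCount (φ g) : ℂ) ^ 2 = 2 * ρ₀.character g + 3 * ρ₁.character g +
      ρ₂.character g + ρ₃.character g := by
    intro g
    have a := character_sumZero (by omega : 0 < n) (φ g)
    have b := fixCount_sq (by omega : 3 ≤ n) (φ g)
    have c : ρ₀.character g = 1 := by simp [ρ₀, Representation.character]
    rw [c]
    change _ = 2 * 1 + 3 * (sumZero n).toRepresentation.character (φ g) +
      (symZero n).toRepresentation.character (φ g) + (altZero n).toRepresentation.character (φ g)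
    linear_combination b - 2 * a
  have hfix' : ∀ g, (fixCount (φ g) : ℂ) ^ 4 =
      (2 * ρ₀.character g + 3 * ρ₁.character g + ρ₂.character g + ρ₃.character g) *
      (2 * ρ₀.character g⁻¹ + 3 * ρ₁.character g⁻¹ + ρ₂.character g⁻¹ + ρ₃.character g⁻¹) := by
    intro g
    rw [← hfix, ← hfix, map_inv, fixCount_inv]
    ring
  have hG : (Fintype.card G : ℂ) ≠ 0 := by simp
  have hsum' : ∑ g, (fixCount (φ g) : ℂ) ^ 4 = N * Fintype.card G := by exact_mod_cast hsum
  have expand : ∑ g, (fixCount (φ g) : ℂ) ^ 4 =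
      4 * (∑ g, ρ₀.character g * ρ₀.character g⁻¹) +
      6 * (∑ g, ρ₀.character g * ρ₁.character g⁻¹) +
      2 * (∑ g, ρ₀.character g * ρ₂.character g⁻¹) +
      2 * (∑ g, ρ₀.character g * ρ₃.character g⁻¹) +
      6 * (∑ g, ρ₁.character g * ρ₀.character g⁻¹) +
      9 * (∑ g, ρ₁.character g * ρ₁.character g⁻¹) +
      3 * (∑ g, ρ₁.character g * ρ₂.character g⁻¹) +
      3 * (∑ g, ρ₁.character g * ρ₃.character g⁻¹) +
      2 * (∑ g, ρ₂.character g * ρ₀.character g⁻¹) +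
      3 * (∑ g, ρ₂.character g * ρ₁.character g⁻¹) +
      1 * (∑ g, ρ₂.character g * ρ₂.character g⁻¹) +
      1 * (∑ g, ρ₂.character g * ρ₃.character g⁻¹) +
      2 * (∑ g, ρ₃.character g * ρ₀.character g⁻¹) +
      3 * (∑ g, ρ₃.character g * ρ₁.character g⁻¹) +
      1 * (∑ g, ρ₃.character g * ρ₂.character g⁻¹) +
      1 * (∑ g, ρ₃.character g * ρ₃.character g⁻¹) := by
    simp only [Finset.mul_sum, ← Finset.sum_add_distrib]
    refine Finset.sum_congr rfl fun g _ => ?_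
    rw [hfix']
    ring
  simp only [sum_char_mul_char_inv] at expand
  rw [hsum'] at expand
  have key : N =
      4 * Module.finrank ℂ (IntertwiningMap ρ₀ ρ₀) +
      6 * Module.finrank ℂ (IntertwiningMap ρ₁ ρ₀) +
      2 * Module.finrank ℂ (IntertwiningMap ρ₂ ρ₀) +
      2 * Module.finrank ℂ (IntertwiningMap ρ₃ ρ₀) +
      6 * Module.finrank ℂ (IntertwiningMap ρ₀ ρ₁) +
      9 * Module.finrank ℂ (IntertwiningMap ρ₁ ρ₁) +
      3 * Module.finrank ℂ (IntertwiningMap ρ₂ ρ₁) +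
      3 * Module.finrank ℂ (IntertwiningMap ρ₃ ρ₁) +
      2 * Module.finrank ℂ (IntertwiningMap ρ₀ ρ₂) +
      3 * Module.finrank ℂ (IntertwiningMap ρ₁ ρ₂) +
      1 * Module.finrank ℂ (IntertwiningMap ρ₂ ρ₂) +
      1 * Module.finrank ℂ (IntertwiningMap ρ₃ ρ₂) +
      2 * Module.finrank ℂ (IntertwiningMap ρ₀ ρ₃) +
      3 * Module.finrank ℂ (IntertwiningMap ρ₁ ρ₃) +
      1 * Module.finrank ℂ (IntertwiningMap ρ₂ ρ₃) +
      1 * Module.finrank ℂ (IntertwiningMap ρ₃ ρ₃) := by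
    apply Nat.cast_injective (R := ℂ)
    apply mul_right_cancel₀ hG
    rw [expand]
    push_cast
    ring
  -- The diagonal terms, with coefficients 4, 9, 1, 1 and dimensions at least 1, already contribute
  -- 15 ≥ `N`. All other terms are nonnegative, so each diagonal dimension is exactly 1.
  have key₁ : Module.finrank ℂ (IntertwiningMap ρ₁ ρ₁) = 1 := by omega
  have key₂ : Module.finrank ℂ (IntertwiningMap ρ₂ ρ₂) = 1 := by omega
  have key₃ : Module.finrank ℂ (IntertwiningMap ρ₃ ρ₃) = 1 := by omega
  have e₁ := sum_char_mul_char_inv ρ₁ ρ₁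
  have e₂ := sum_char_mul_char_inv ρ₂ ρ₂
  have e₃ := sum_char_mul_char_inv ρ₃ ρ₃
  rw [key₁, Nat.cast_one, one_mul] at e₁
  rw [key₂, Nat.cast_one, one_mul] at e₂
  rw [key₃, Nat.cast_one, one_mul] at e₃
  have hc : ∀ {V : Type} [AddCommGroup V] [Module ℂ V] (τ : Representation ℂ (Perm (Fin n)) V)
      (g : G), τ.character (φ g)⁻¹ = Representation.character (τ.comp φ) g⁻¹ := by
    intro V _ _ τ g
    rw [← map_inv]
    rfl
  simp only [hc]
  exact ⟨e₁, e₂, e₃⟩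

end Transitive

/-! ### Pattern transitivity of Sₙ and Aₙ -/

/-- Equal patterns make `x i ↦ y i` a well-defined bijection between the two ranges, and a bijection
between subsets of a finite set extends to a permutation. -/
theorem exists_perm_extending {n : ℕ} (x y : Fin 4 → Fin n) (h : ∀ i j, x i = x j ↔ y i = y j) :
    ∃ σ : Perm (Fin n), ∀ i, σ (x i) = y i := by
  classical
  have hx : ∀ a : {a // a ∈ Set.range x}, x a.2.choose = a.1 := fun a => a.2.choose_spec
  let e : {a // a ∈ Set.range x} ≃ {a // a ∈ Set.range y} :=
    Equiv.ofBijective (fun a => ⟨y a.2.choose, _, rfl⟩) (by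
      constructor
      · intro a b hab
        have := (h _ _).2 (congrArg Subtype.val hab)
        rw [hx, hx] at this
        exact Subtype.ext this
      · rintro ⟨_, i, rfl⟩
        refine ⟨⟨x i, i, rfl⟩, Subtype.ext ((h _ _).1 ?_)⟩
        exact hx ⟨x i, i, rfl⟩)
  refine ⟨e.extendSubtype, fun i => ?_⟩
  rw [Equiv.extendSubtype_apply_of_mem _ _ ⟨i, rfl⟩]
  exact (h _ _).1 (hx ⟨x i, i, rfl⟩)

theorem patternTransitive_perm (n : ℕ) :
    PatternTransitive (MonoidHom.id (Perm (Fin n))) :=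
  exists_perm_extending

/-- A quadruple uses at most four letters, so two of the at least six are free. Swapping those
corrects the sign of an odd extension without moving any `y i`. -/
theorem patternTransitive_alternating {n : ℕ} (hn : 6 ≤ n) :
    PatternTransitive (alternatingGroup (Fin n)).subtype := by
  classical
  intro x y h
  obtain ⟨σ, hσ⟩ := exists_perm_extending x y h
  rcases Int.units_eq_one_or (Perm.sign σ) with hs | hs
  · exact ⟨⟨σ, hs⟩, hσ⟩
  · have hc : 1 < (Finset.univ.image y)ᶜ.card := by
      have := Finset.card_image_le (s := Finset.univ) (f := y)
      rw [Finset.card_compl]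
      simp only [Finset.card_univ, Fintype.card_fin] at *
      omega
    obtain ⟨u, hu, v, hv, huv⟩ := Finset.one_lt_card.1 hc
    refine ⟨⟨swap u v * σ, ?_⟩, fun i => ?_⟩
    · rw [Perm.mem_alternatingGroup, Perm.sign_mul, hs, Perm.sign_swap huv]; rfl
    · simp only [Finset.mem_compl, Finset.mem_image, Finset.mem_univ, true_and, not_exists] at hu hv
      change swap u v (σ (x i)) = y i
      rw [hσ]
      exact swap_apply_of_ne_of_ne (hu i) (hv i)

/-! ### Enumeration in A₄ and A₅ -/

theorem sum_alternating_four_sumZero :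
    ∑ g : alternatingGroup (Fin 4), ((fixCount (g : Perm (Fin 4)) : ℤ) - 1) ^ 2 =
      (Fintype.card (alternatingGroup (Fin 4)) : ℤ) := by
  decide +kernel

/-- The expression being squared is twice the character of `altZero`, which keeps it integral; hence
the factor 4. -/
theorem sum_alternating_four_altZero :
    ∑ g : alternatingGroup (Fin 4), ((fixCount (g : Perm (Fin 4)) : ℤ) ^ 2 -
      fixCount ((g * g : Perm (Fin 4))) - 2 * fixCount (g : Perm (Fin 4)) + 2) ^ 2 =
      4 * (Fintype.card (alternatingGroup (Fin 4)) : ℤ) := by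
  decide +kernel

theorem sum_alternating_five_sumZero :
    ∑ g : alternatingGroup (Fin 5), ((fixCount (g : Perm (Fin 5)) : ℤ) - 1) ^ 2 =
      (Fintype.card (alternatingGroup (Fin 5)) : ℤ) := by
  decide +kernel

theorem sum_alternating_five_symZero :
    ∑ g : alternatingGroup (Fin 5), ((fixCount (g : Perm (Fin 5)) : ℤ) ^ 2 +
      fixCount ((g * g : Perm (Fin 5))) - 4 * fixCount (g : Perm (Fin 5))) ^ 2 =
      4 * (Fintype.card (alternatingGroup (Fin 5)) : ℤ) := by
  decide +kernel

/-! ### Row lengths and existence of tableaux -/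

section Shapes

theorem rowLen_ofRowLens_eq (w : List ℕ) (hw : w.SortedGE) (i : ℕ) :
    (YoungDiagram.ofRowLens w hw).rowLen i = w.getD i 0 := by
  refine eq_of_forall_lt_iff fun j => ?_
  rw [← YoungDiagram.mem_iff_lt_rowLen, YoungDiagram.mem_ofRowLens]
  by_cases h : i < w.length
  · simp [h]
  · simp [h]

theorem card_cellsOfRowLens (w : List ℕ) : (YoungDiagram.cellsOfRowLens w).card = w.sum := by
  induction w with
  | nil => rfl
  | cons a w ih =>
    rw [YoungDiagram.cellsOfRowLens, Finset.card_union_of_disjoint, Finset.card_map, ih]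
    · simp
    · rw [Finset.disjoint_left]
      rintro ⟨i, j⟩ h h'
      simp only [Finset.mem_product, Finset.mem_singleton] at h
      simp only [Finset.mem_map] at h'
      obtain ⟨c, -, hc⟩ := h'
      have := congrArg Prod.fst hc
      simp [h.1] at this

theorem nonempty_tableau {n : ℕ} {w : List ℕ} (hw : w.SortedGE) (h : w.sum = n) :
    Nonempty (Tableau n (YoungDiagram.ofRowLens w hw)) := by
  refine ⟨Fintype.equivFinOfCardEq ?_⟩
  rw [Fintype.card_coe, ← h, ← card_cellsOfRowLens]
  rfl

end Shapes

/-! ### Signed sums over column stabilizers -/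

variable {n : ℕ} {μ : YoungDiagram}

theorem Tabloid.rowLen_pos (r : Tabloid n μ) (k : Fin n) : 0 < μ.rowLen (r.1 k) := by
  rw [← r.2, Finset.card_pos]
  exact ⟨k, by simp⟩

theorem Tabloid.row_lt_length {w : List ℕ} {hw : w.SortedGE}
    (r : Tabloid n (YoungDiagram.ofRowLens w hw)) (k : Fin n) : r.1 k < w.length := by
  by_contra h
  have := r.rowLen_pos k
  rw [rowLen_ofRowLens_eq, List.getD_eq_default _ _ (not_lt.1 h)] at this
  exact lt_irrefl _ this

theorem Tableau.swap_mem_columnStabilizer (T : Tableau n μ) {c c' : {c : ℕ × ℕ // c ∈ μ.cells}}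
    (h : c.1.2 = c'.1.2) : swap (T c) (T c') ∈ T.columnStabilizer := by
  simp only [Tableau.columnStabilizer, Finset.mem_filter, Finset.mem_univ, true_and]
  intro k
  rw [swap_apply_def]
  split_ifs with h1 h2
  · rw [h1]; simp [h]
  · rw [h2]; simp [h]
  · rfl

/-- Right translation by an odd `t` permutes the column stabilizer and flips every sign. -/
theorem Tableau.sum_sign_mul_right (T : Tableau n μ) {t : Perm (Fin n)}
    (ht : t ∈ T.columnStabilizer) (hs : Perm.sign t = -1) (f : Perm (Fin n) → ℂ) :
    ∑ σ ∈ T.columnStabilizer, (((Perm.sign σ : ℤˣ) : ℤ) : ℂ) * f (σ * t) =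
      -∑ σ ∈ T.columnStabilizer, (((Perm.sign σ : ℤˣ) : ℤ) : ℂ) * f σ := by
  simp only [Tableau.columnStabilizer, Finset.mem_filter, Finset.mem_univ, true_and] at ht
  have ht' : ∀ k, (T.symm (t⁻¹ k)).1.2 = (T.symm k).1.2 := fun k => by
    rw [← ht (t⁻¹ k), show t (t⁻¹ k) = k from t.apply_symm_apply k]
  rw [← Finset.sum_neg_distrib]
  refine Finset.sum_bij' (fun σ _ => σ * t) (fun σ _ => σ * t⁻¹) ?_ ?_ ?_ ?_ ?_
  · intro σ hσ
    simp only [Tableau.columnStabilizer, Finset.mem_filter, Finset.mem_univ, true_and] at hσ ⊢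
    intro k
    rw [Perm.mul_apply, hσ, ht]
  · intro σ hσ
    simp only [Tableau.columnStabilizer, Finset.mem_filter, Finset.mem_univ, true_and] at hσ ⊢
    intro k
    rw [Perm.mul_apply, hσ, ht']
  · intro σ _; simp
  · intro σ _; simp
  · intro σ _
    rw [Perm.sign_mul, hs]
    simp

theorem Tableau.sum_sign_eq_zero (T : Tableau n μ) {t : Perm (Fin n)}
    (ht : t ∈ T.columnStabilizer) (hs : Perm.sign t = -1) (f : Perm (Fin n) → ℂ)
    (hf : ∀ σ, f (σ * t) = f σ) :
    ∑ σ ∈ T.columnStabilizer, (((Perm.sign σ : ℤˣ) : ℤ) : ℂ) * f σ = 0 := by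
  have := T.sum_sign_mul_right ht hs f
  simp only [hf] at this
  exact self_eq_neg.1 this

/-- Swapping two entries of one column, neither equal to `x`, does not affect the indicator. This
yields the vanishing row sums for the two-row and hook shapes. -/
theorem Tableau.sum_sign_indicator_eq_zero (T : Tableau n μ) {c c' : {c : ℕ × ℕ // c ∈ μ.cells}}
    (h : c.1.2 = c'.1.2) (hcc : c ≠ c') {x : Fin n} (h1 : x ≠ T c) (h2 : x ≠ T c') (i : Fin n) :
    ∑ σ ∈ T.columnStabilizer,
      (((Perm.sign σ : ℤˣ) : ℤ) : ℂ) * (if σ⁻¹ i = x then 1 else 0) = 0 := by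
  refine T.sum_sign_eq_zero (T.swap_mem_columnStabilizer h)
    (Perm.sign_swap (T.injective.ne hcc)) _ fun σ => ?_
  have : (σ * swap (T c) (T c'))⁻¹ i = x ↔ σ⁻¹ i = x := by
    rw [mul_inv_rev, swap_inv, Perm.mul_apply, swap_apply_eq_iff, swap_apply_of_ne_of_ne h1 h2]
  simp only [this]

/-- The coefficient at `{T}` is 1: a column-preserving permutation that also fixes the tabloid
preserves rows, hence every box. -/
theorem Tableau.polytabloid_ne_zero (T : Tableau n μ) : T.polytabloid ≠ 0 := by
  classical
  intro h
  have h' := congrArg (fun v : MonoidAlgebra ℂ (Tabloid n μ) => v.coeff T.tabloid) h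
  simp only [Tableau.polytabloid, MonoidAlgebra.coeff_sum, Finsupp.finsetSum_apply,
    MonoidAlgebra.coeff_smul_apply, MonoidAlgebra.coeff_single, Finsupp.single_apply] at h'
  rw [Finset.sum_eq_single 1] at h'
  · have : (Tableau.act 1 T).tabloid = T.tabloid := rfl
    simp [this] at h'
  · intro σ hσ h1
    rw [if_neg, smul_zero]
    intro he
    apply h1
    simp only [Tableau.columnStabilizer, Finset.mem_filter, Finset.mem_univ, true_and] at hσ
    ext1 k
    have hr : (T.symm (σ⁻¹ (σ k))).1.1 = (T.symm (σ k)).1.1 :=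
      congrFun (congrArg Subtype.val he) (σ k)
    rw [show σ⁻¹ (σ k) = k from σ.symm_apply_apply k] at hr
    exact T.symm.injective (Subtype.ext (Prod.ext hr.symm (hσ k)))
  · intro h1
    exact absurd (by simp [Tableau.columnStabilizer]) h1

theorem nontrivial_specht (hT : Nonempty (Tableau n μ)) : Nontrivial (specht n μ).toSubmodule := by
  obtain ⟨T⟩ := hT
  exact ⟨⟨⟨T.polytabloid, Submodule.subset_span ⟨T, rfl⟩⟩, 0, fun h =>
    T.polytabloid_ne_zero (congrArg Subtype.val h)⟩⟩

instance : FiniteDimensional ℂ (specht n μ).toSubmodule :=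
  FiniteDimensional.span_of_finite ℂ (Set.finite_range _)

/-! ### Specht modules inside the function models -/

/-- Linear extension of a map defined on tabloids. -/
noncomputable def tabloidLift {Y : Type*} (F : Tabloid n μ → Y → ℂ) :
    MonoidAlgebra ℂ (Tabloid n μ) →ₗ[ℂ] (Y → ℂ) :=
  Finsupp.linearCombination ℂ F ∘ₗ (MonoidAlgebra.coeffLinearEquiv ℂ).toLinearMap

theorem tabloidLift_single {Y : Type*} (F : Tabloid n μ → Y → ℂ) (r : Tabloid n μ) (c : ℂ) :
    tabloidLift F (MonoidAlgebra.single r c) = c • F r := by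
  simp [tabloidLift]

theorem tabloidLift_injective {Y : Type*} (F : Tabloid n μ → Y → ℂ)
    (hsep : ∀ r, ∃ y, F r y = 1 ∧ ∀ r', r' ≠ r → F r' y = 0) :
    Function.Injective (tabloidLift F) := by
  rw [injective_iff_map_eq_zero]
  intro v hv
  ext r
  obtain ⟨y, hy, hy'⟩ := hsep r
  have h : tabloidLift F v y = 0 := by rw [hv]; rfl
  simp only [tabloidLift, LinearMap.comp_apply, Finsupp.linearCombination_apply, Finsupp.sum,
    Finset.sum_apply, Pi.smul_apply, smul_eq_mul] at h
  rw [Finset.sum_eq_single r] at h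
  · simpa [hy] using h
  · intro r' _ hr'
    rw [hy' r' hr', mul_zero]
  · intro hr
    rw [Finsupp.notMem_support_iff.1 hr, zero_mul]

/-- `F` extends to an equivariant map, injective because `hsep` gives each tabloid a point where
only it is nonzero. By `hmem` it carries the Specht module into the irreducible `K`, so it is onto
`K`. -/
theorem character_specht_eq {Y : Type*} {ρ : Representation ℂ (Perm (Fin n)) (Y → ℂ)}
    (K : Subrepresentation ρ) (hK : K.toRepresentation.IsIrreducible)
    (hT : Nonempty (Tableau n μ)) (F : Tabloid n μ → Y → ℂ)
    (hF : ∀ (σ : Perm (Fin n)) r, F (σ • r) = ρ σ (F r))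
    (hsep : ∀ r, ∃ y, F r y = 1 ∧ ∀ r', r' ≠ r → F r' y = 0)
    (hmem : ∀ T : Tableau n μ, ∑ σ ∈ T.columnStabilizer,
      (((Perm.sign σ : ℤˣ) : ℤ) : ℂ) • F (T.act σ).tabloid ∈ K.toSubmodule) :
    (specht n μ).toRepresentation.character = K.toRepresentation.character := by
  have := nontrivial_specht hT
  have hle : ∀ v ∈ (specht n μ).toSubmodule, tabloidLift F v ∈ K.toSubmodule := by
    intro v hv
    change v ∈ Submodule.span ℂ _ at hv
    refine (Submodule.span_le (p := K.toSubmodule.comap (tabloidLift F))).2 ?_ hv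
    rintro _ ⟨T, rfl⟩
    simp only [SetLike.mem_coe, Submodule.mem_comap, Tableau.polytabloid, map_sum, map_smul,
      tabloidLift_single, one_smul]
    exact hmem T
  have hequiv : ∀ (σ : Perm (Fin n)) (v : MonoidAlgebra ℂ (Tabloid n μ)),
      tabloidLift F (tabloidRep n μ σ v) = ρ σ (tabloidLift F v) := by
    intro σ v
    induction v using MonoidAlgebra.induction_linear with
    | zero => simp
    | add x y hx hy => simp only [map_add, hx, hy]
    | single r c =>
      rw [tabloidRep, ofMulAction_single, tabloidLift_single, tabloidLift_single, hF, map_smul]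
  refine character_eq_of_injective hK
    (LinearMap.intertwiningMap_of_isIntertwiningMap _ _ ((tabloidLift F).restrict hle)
      fun σ v => Subtype.ext (hequiv σ v.1)) ?_
  intro v w h
  exact Subtype.ext (tabloidLift_injective F hsep (congrArg Subtype.val h))

/-- There is only one tabloid, so the Specht module is a line with trivial action. -/
theorem character_specht_one_row (hw : [n].SortedGE) (σ : Perm (Fin n)) :
    (specht n (YoungDiagram.ofRowLens [n] hw)).toRepresentation.character σ = 1 := by
  have hr : ∀ r r' : Tabloid n (YoungDiagram.ofRowLens [n] hw), r = r' := by
    intro r r'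
    apply Subtype.ext
    funext k
    have h1 := r.row_lt_length k
    have h2 := r'.row_lt_length k
    simp only [List.length_singleton] at h1 h2
    omega
  have hid : tabloidRep n (YoungDiagram.ofRowLens [n] hw) σ = LinearMap.id := by
    refine LinearMap.ext fun v => ?_
    induction v using MonoidAlgebra.induction_linear with
    | zero => simp
    | add x y hx hy => rw [map_add, hx, hy]; rfl
    | single r c => rw [tabloidRep, ofMulAction_single, hr (σ • r) r]; rfl
  have hid' : (specht n (YoungDiagram.ofRowLens [n] hw)).toRepresentation σ = LinearMap.id := by
    refine LinearMap.ext fun v => Subtype.ext ?_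
    exact congrArg (fun f => f v.1) hid
  obtain ⟨T⟩ := nonempty_tableau (n := n) hw (by simp)
  have h0 : (⟨T.polytabloid, Submodule.subset_span ⟨T, rfl⟩⟩ :
      (specht n (YoungDiagram.ofRowLens [n] hw)).toSubmodule) ≠ 0 := fun h =>
    T.polytabloid_ne_zero (congrArg Subtype.val h)
  have hc : T.polytabloid.coeff T.tabloid ≠ 0 := by
    intro hc
    apply T.polytabloid_ne_zero
    ext r
    rw [hr r T.tabloid, hc]
    rfl
  rw [Representation.character, hid', LinearMap.trace_id, (finrank_eq_one_iff_of_nonzero' _ h0).2]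
  · simp
  · intro w
    refine ⟨w.1.coeff T.tabloid / T.polytabloid.coeff T.tabloid, Subtype.ext ?_⟩
    ext r
    change w.1.coeff T.tabloid / T.polytabloid.coeff T.tabloid * T.polytabloid.coeff r = _
    rw [hr r T.tabloid]
    field_simp

theorem isIrreducible_symmetric (hn : 4 ≤ n) : (sumZero n).toRepresentation.IsIrreducible ∧
    (symZero n).toRepresentation.IsIrreducible ∧ (altZero n).toRepresentation.IsIrreducible := by
  obtain ⟨h1, h2, h3⟩ := sum_char_of_patternTransitive hn _ (patternTransitive_perm n)
  exact ⟨isIrreducible_of_sum_char _ h1, isIrreducible_of_sum_char _ h2,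
    isIrreducible_of_sum_char _ h3⟩

theorem Tableau.row_eq_iff (T : Tableau n μ) (c : {c : ℕ × ℕ // c ∈ μ.cells})
    (hc : μ.rowLen c.1.1 = 1) (x : Fin n) : (T.symm x).1.1 = c.1.1 ↔ x = T c := by
  rw [← T.symm_apply_eq]
  refine ⟨fun h => ?_, fun h => by rw [h]⟩
  have h1 : c.1 ∈ μ := c.2
  have h2 : (T.symm x).1 ∈ μ := (T.symm x).2
  rw [← Prod.mk.eta (p := c.1), YoungDiagram.mem_iff_lt_rowLen, hc] at h1
  rw [← Prod.mk.eta (p := (T.symm x).1), YoungDiagram.mem_iff_lt_rowLen, h, hc] at h2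
  exact Subtype.ext (Prod.ext h (by omega))

/-- A tabloid is determined by its one letter in the lower row and maps to the indicator of that
letter. -/
theorem character_specht_standard (hn : 4 ≤ n) (hw : [n - 1, 1].SortedGE) :
    (specht n (YoungDiagram.ofRowLens [n - 1, 1] hw)).toRepresentation.character =
      (sumZero n).toRepresentation.character := by
  classical
  set μ := YoungDiagram.ofRowLens [n - 1, 1] hw with hμ
  have hlen : μ.rowLen 1 = 1 := by rw [hμ, rowLen_ofRowLens_eq]; rfl
  refine character_specht_eq (sumZero n) (isIrreducible_symmetric hn).1
    (nonempty_tableau hw (by simp; omega)) (fun r i => if r.1 i = 1 then 1 else 0)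
    (fun σ r => rfl) ?_ ?_
  · intro r
    obtain ⟨i, hi⟩ := Finset.card_eq_one.1 ((r.2 1).trans hlen)
    have hri : ∀ k, r.1 k = 1 ↔ k = i := fun k => by
      simpa using Finset.ext_iff.1 hi k
    refine ⟨i, if_pos ((hri i).2 rfl), fun r' hr' => if_neg fun h => hr' ?_⟩
    obtain ⟨i', hi'⟩ := Finset.card_eq_one.1 ((r'.2 1).trans hlen)
    have hri' : ∀ k, r'.1 k = 1 ↔ k = i' := fun k => by
      simpa using Finset.ext_iff.1 hi' k
    obtain rfl := (hri' i).1 h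
    apply Subtype.ext
    funext k
    have h1 : r.1 k < 2 := r.row_lt_length k
    have h2 : r'.1 k < 2 := r'.row_lt_length k
    have := (hri k).trans (hri' k).symm
    omega
  · intro T
    have m0 : ((0, 0) : ℕ × ℕ) ∈ μ.cells := by
      rw [YoungDiagram.mem_cells, hμ, YoungDiagram.mem_ofRowLens]; simp; omega
    have m1 : ((1, 0) : ℕ × ℕ) ∈ μ.cells := by
      rw [YoungDiagram.mem_cells, hμ, YoungDiagram.mem_ofRowLens]; simp
    have hb := T.row_eq_iff ⟨(1, 0), m1⟩ hlen
    rw [mem_sumZero]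
    have hval : ∀ (σ : Perm (Fin n)) i, (T.act σ).tabloid.1 i = (T.symm (σ⁻¹ i)).1.1 :=
      fun _ _ => rfl
    simp only [Finset.sum_apply, Pi.smul_apply, smul_eq_mul, hval, hb]
    rw [Finset.sum_comm]
    simp only [← Finset.mul_sum]
    have hsum : ∀ σ : Perm (Fin n),
        ∑ i, (if σ⁻¹ i = T ⟨(1, 0), m1⟩ then (1 : ℂ) else 0) = 1 := by
      intro σ
      simp only [Perm.inv_eq_iff_eq]
      simp
    -- Each indicator has total 1, so what remains is the sum of signs, which the odd swap in the
    -- first column cancels.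
    refine T.sum_sign_eq_zero
      (T.swap_mem_columnStabilizer (c := ⟨(0, 0), m0⟩) (c' := ⟨(1, 0), m1⟩) rfl)
      (Perm.sign_swap (T.injective.ne (by simp))) _ fun σ => ?_
    rw [hsum, hsum]

/-- A tabloid maps to the indicator of the two ordered pairs formed by its lower-row letters. The
row sum at `i` says whether `i` is one of these letters; each of the two cases is cancelled by the
swap in the column not containing that letter. -/
theorem character_specht_two_two (hn : 4 ≤ n) (hw : [n - 2, 2].SortedGE) :
    (specht n (YoungDiagram.ofRowLens [n - 2, 2] hw)).toRepresentation.character =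
      (symZero n).toRepresentation.character := by
  classical
  set μ := YoungDiagram.ofRowLens [n - 2, 2] hw with hμ
  have hlen : μ.rowLen 1 = 2 := by rw [hμ, rowLen_ofRowLens_eq]; rfl
  refine character_specht_eq (symZero n) (isIrreducible_symmetric hn).2.1
    (nonempty_tableau hw (by simp; omega))
    (fun r a => if r.1 a.1 = 1 ∧ r.1 a.2 = 1 ∧ a.1 ≠ a.2 then 1 else 0) ?_ ?_ ?_
  · intro σ r
    ext ⟨i, j⟩
    have h : ∀ k, (σ • r).1 k = r.1 (σ⁻¹ k) := fun _ => rfl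
    simp only [pairRep_apply, h, ne_eq, EmbeddingLike.apply_eq_iff_eq]
  · have key : ∀ (r : Tabloid n μ) (i j : Fin n), i ≠ j → r.1 i = 1 → r.1 j = 1 →
        ∀ k, r.1 k = 1 ↔ k = i ∨ k = j := by
      intro r i j hij hi hj k
      have : ({i, j} : Finset (Fin n)) = Finset.univ.filter fun k => r.1 k = 1 := by
        refine Finset.eq_of_subset_of_card_le ?_ ?_
        · intro k hk
          rcases Finset.mem_insert.1 hk with rfl | hk
          · simpa using hi
          · rw [Finset.mem_singleton.1 hk]; simpa using hj
        · rw [Finset.card_pair hij, r.2 1, hlen]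
      simpa using (Finset.ext_iff.1 this k).symm
    intro r
    obtain ⟨i, j, hij, hs⟩ := Finset.card_eq_two.1 ((r.2 1).trans hlen)
    have hri : ∀ k, r.1 k = 1 ↔ k = i ∨ k = j := fun k => by
      simpa using Finset.ext_iff.1 hs k
    refine ⟨(i, j), if_pos ⟨(hri i).2 (.inl rfl), (hri j).2 (.inr rfl), hij⟩,
      fun r' hr' => if_neg fun h => hr' ?_⟩
    have hri' := key r' i j hij h.1 h.2.1
    apply Subtype.ext
    funext k
    have h1 : r.1 k < 2 := r.row_lt_length k
    have h2 : r'.1 k < 2 := r'.row_lt_length k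
    have := (hri k).trans (hri' k).symm
    omega
  · intro T
    have mem : ∀ i j, i < 2 → j < 2 → ((i, j) : ℕ × ℕ) ∈ μ.cells := by
      intro i j hi hj
      rw [YoungDiagram.mem_cells, hμ, YoungDiagram.mem_ofRowLens]
      interval_cases i <;> (simp; try omega)
    have m00 := mem 0 0 (by omega) (by omega)
    have m01 := mem 0 1 (by omega) (by omega)
    have m10 := mem 1 0 (by omega) (by omega)
    have m11 := mem 1 1 (by omega) (by omega)
    have hbd : T ⟨(1, 0), m10⟩ ≠ T ⟨(1, 1), m11⟩ := T.injective.ne (by simp)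
    have hrow : ∀ x, (T.symm x).1.1 = 1 ↔ x = T ⟨(1, 0), m10⟩ ∨ x = T ⟨(1, 1), m11⟩ := by
      intro x
      rw [← T.symm_apply_eq, ← T.symm_apply_eq]
      constructor
      · intro h
        have h2 : (T.symm x).1 ∈ μ := (T.symm x).2
        rw [← Prod.mk.eta (p := (T.symm x).1), YoungDiagram.mem_iff_lt_rowLen, h, hlen] at h2
        rcases (by omega : (T.symm x).1.2 = 0 ∨ (T.symm x).1.2 = 1) with h0 | h0
        · exact .inl (Subtype.ext (Prod.ext h h0))
        · exact .inr (Subtype.ext (Prod.ext h h0))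
      · rintro (h | h) <;> rw [h]
    have hval : ∀ (σ : Perm (Fin n)) i, (T.act σ).tabloid.1 i = (T.symm (σ⁻¹ i)).1.1 :=
      fun _ _ => rfl
    have hpt : ∀ (σ : Perm (Fin n)) (i j : Fin n),
        (if (σ⁻¹ i = T ⟨(1, 0), m10⟩ ∨ σ⁻¹ i = T ⟨(1, 1), m11⟩) ∧
          (σ⁻¹ j = T ⟨(1, 0), m10⟩ ∨ σ⁻¹ j = T ⟨(1, 1), m11⟩) ∧ i ≠ j then (1 : ℂ) else 0) =
        (if σ⁻¹ i = T ⟨(1, 0), m10⟩ then if j = σ (T ⟨(1, 1), m11⟩) then 1 else 0 else 0) +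
        (if σ⁻¹ i = T ⟨(1, 1), m11⟩ then if j = σ (T ⟨(1, 0), m10⟩) then 1 else 0 else 0) := by
      intro σ i j
      simp only [Perm.inv_eq_iff_eq]
      have hbd' := σ.injective.ne hbd
      generalize σ (T ⟨(1, 0), m10⟩) = b at *
      generalize σ (T ⟨(1, 1), m11⟩) = d at *
      by_cases h1 : i = b
      · subst h1
        by_cases h2 : j = d
        · subst h2; simp [hbd']
        · simp [h2, hbd', eq_comm]
      · by_cases h2 : i = d
        · subst h2
          by_cases h3 : j = b
          · subst h3; simp [h1]
          · simp [h1, h3, eq_comm]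
        · simp [h1, h2]
    rw [mem_symZero]
    simp only [Finset.sum_apply, Pi.smul_apply, smul_eq_mul, hval, hrow]
    refine ⟨fun i j => ?_, fun i => by simp, fun i => ?_⟩
    · refine Finset.sum_congr rfl fun σ _ => ?_
      congr 2
      rw [ne_comm]
      exact propext ⟨fun h => ⟨h.2.1, h.1, h.2.2⟩, fun h => ⟨h.2.1, h.1, h.2.2⟩⟩
    · rw [Finset.sum_comm]
      simp only [← Finset.mul_sum, hpt, Finset.sum_add_distrib, mul_add]
      have e : ∀ (σ : Perm (Fin n)) (p : Prop) [Decidable p] (x : Fin n),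
          ∑ j, (if p then if j = x then (1 : ℂ) else 0 else 0) = if p then 1 else 0 := by
        intro σ p _ x
        split_ifs <;> simp
      simp only [e 1]
      rw [T.sum_sign_indicator_eq_zero (c := ⟨(0, 1), m01⟩) (c' := ⟨(1, 1), m11⟩) rfl (by simp)
        (T.injective.ne (by simp)) (T.injective.ne (by simp)),
        T.sum_sign_indicator_eq_zero (c := ⟨(0, 0), m00⟩) (c' := ⟨(1, 0), m10⟩) rfl (by simp)
        (T.injective.ne (by simp)) (T.injective.ne (by simp)), add_zero]

/-- A tabloid maps to the indicator of the pair (letter of row 1, letter of row 2). Swapping the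
boxes (1,0) and (2,0) gives antisymmetry; swapping (0,0) and (2,0) kills the row sums. -/
theorem character_specht_hook (hn : 4 ≤ n) (hw : [n - 2, 1, 1].SortedGE) :
    (specht n (YoungDiagram.ofRowLens [n - 2, 1, 1] hw)).toRepresentation.character =
      (altZero n).toRepresentation.character := by
  classical
  set μ := YoungDiagram.ofRowLens [n - 2, 1, 1] hw with hμ
  have hlen1 : μ.rowLen 1 = 1 := by rw [hμ, rowLen_ofRowLens_eq]; rfl
  have hlen2 : μ.rowLen 2 = 1 := by rw [hμ, rowLen_ofRowLens_eq]; rfl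
  refine character_specht_eq (altZero n) (isIrreducible_symmetric hn).2.2
    (nonempty_tableau hw (by simp; omega))
    (fun r a => if r.1 a.1 = 1 ∧ r.1 a.2 = 2 then 1 else 0) (fun σ r => rfl) ?_ ?_
  · have key : ∀ (l : ℕ), μ.rowLen l = 1 → ∀ (r : Tabloid n μ) (i : Fin n), r.1 i = l →
        ∀ k, r.1 k = l ↔ k = i := by
      intro l hl r i hi k
      obtain ⟨i', hi'⟩ := Finset.card_eq_one.1 ((r.2 l).trans hl)
      have hri : ∀ k, r.1 k = l ↔ k = i' := fun k => by
        simpa using Finset.ext_iff.1 hi' k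
      rw [hri k, (hri i).1 hi]
    intro r
    obtain ⟨i, hi⟩ := Finset.card_pos.1 (((r.2 1).trans hlen1).symm ▸ Nat.one_pos)
    obtain ⟨j, hj⟩ := Finset.card_pos.1 (((r.2 2).trans hlen2).symm ▸ Nat.one_pos)
    rw [Finset.mem_filter] at hi hj
    refine ⟨(i, j), if_pos ⟨hi.2, hj.2⟩, fun r' hr' => if_neg fun h => hr' ?_⟩
    apply Subtype.ext
    funext k
    have h1 : r.1 k < 3 := r.row_lt_length k
    have h2 : r'.1 k < 3 := r'.row_lt_length k
    have e1 := (key 1 hlen1 r i hi.2 k).trans (key 1 hlen1 r' i h.1 k).symm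
    have e2 := (key 2 hlen2 r j hj.2 k).trans (key 2 hlen2 r' j h.2 k).symm
    omega
  · intro T
    have mem : ∀ i, i < 3 → ((i, 0) : ℕ × ℕ) ∈ μ.cells := by
      intro i hi
      rw [YoungDiagram.mem_cells, hμ, YoungDiagram.mem_ofRowLens]
      interval_cases i <;> (simp; try omega)
    have m0 := mem 0 (by omega)
    have m1 := mem 1 (by omega)
    have m2 := mem 2 (by omega)
    have hb := T.row_eq_iff ⟨(1, 0), m1⟩ hlen1
    have hc := T.row_eq_iff ⟨(2, 0), m2⟩ hlen2
    have hval : ∀ (σ : Perm (Fin n)) i, (T.act σ).tabloid.1 i = (T.symm (σ⁻¹ i)).1.1 :=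
      fun _ _ => rfl
    rw [mem_altZero]
    simp only [Finset.sum_apply, Pi.smul_apply, smul_eq_mul, hval, hb, hc]
    refine ⟨fun i j => ?_, fun i => ?_⟩
    · rw [← T.sum_sign_mul_right (T.swap_mem_columnStabilizer (c := ⟨(1, 0), m1⟩)
        (c' := ⟨(2, 0), m2⟩) rfl) (Perm.sign_swap (T.injective.ne (by simp)))
        (fun σ => if σ⁻¹ j = T ⟨(1, 0), m1⟩ ∧ σ⁻¹ i = T ⟨(2, 0), m2⟩ then 1 else 0)]
      refine Finset.sum_congr rfl fun σ _ => ?_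
      congr 2
      rw [mul_inv_rev, swap_inv, Perm.mul_apply, Perm.mul_apply, swap_apply_eq_iff,
        swap_apply_eq_iff, swap_apply_left, swap_apply_right, and_comm]
    · rw [Finset.sum_comm]
      simp only [← Finset.mul_sum]
      refine Eq.trans (Finset.sum_congr rfl fun σ _ => ?_) (T.sum_sign_indicator_eq_zero
        (c := ⟨(0, 0), m0⟩) (c' := ⟨(2, 0), m2⟩) rfl (by simp) (x := T ⟨(1, 0), m1⟩)
        (T.injective.ne (by simp)) (T.injective.ne (by simp)) i)
      congr 1
      simp only [Perm.inv_eq_iff_eq]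
      by_cases h : i = σ (T ⟨(1, 0), m1⟩) <;> simp [h]

/-! ### Self-conjugate exceptions and restriction to Aₙ -/

theorem transpose_two_two (hw : [2, 2].SortedGE) :
    (YoungDiagram.ofRowLens [2, 2] hw).transpose = YoungDiagram.ofRowLens [2, 2] hw :=
  YoungDiagram.ext (by decide +revert)

theorem transpose_three_one_one (hw : [3, 1, 1].SortedGE) :
    (YoungDiagram.ofRowLens [3, 1, 1] hw).transpose = YoungDiagram.ofRowLens [3, 1, 1] hw :=
  YoungDiagram.ext (by decide +revert)

section AlternatingGroup

variable {n : ℕ}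

theorem altSpecht_isIrreducible {μ : YoungDiagram} {χ : Perm (Fin n) → ℂ}
    (h : (specht n μ).toRepresentation.character = χ)
    (hχ : ∑ g : alternatingGroup (Fin n), χ g * χ (g : Perm (Fin n))⁻¹ =
      Fintype.card (alternatingGroup (Fin n))) : (altSpecht n μ).IsIrreducible := by
  subst h
  exact isIrreducible_of_sum_char _ hχ

/-- Transfers the integer enumerations to complex characters: `c` is 1 or 2, clearing the
denominator in the character formula. -/
theorem sum_mul_inv_eq_card {χ : Perm (Fin n) → ℂ} {f : Perm (Fin n) → ℤ} {c : ℂ} (hc : c ≠ 0)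
    (hχ : ∀ σ, c * χ σ = f σ) (hf : ∀ σ, f σ⁻¹ = f σ)
    (h : (∑ g : alternatingGroup (Fin n), (f g : ℂ) ^ 2) =
      c ^ 2 * Fintype.card (alternatingGroup (Fin n))) :
    ∑ g : alternatingGroup (Fin n), χ g * χ (g : Perm (Fin n))⁻¹ =
      Fintype.card (alternatingGroup (Fin n)) := by
  apply mul_left_cancel₀ (pow_ne_zero 2 hc)
  rw [← h, Finset.mul_sum]
  refine Finset.sum_congr rfl fun g _ => ?_
  rw [sq, mul_mul_mul_comm, hχ, hχ, hf, sq]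

theorem fixCount_inv_mul_inv (σ : Perm (Fin n)) : fixCount (σ⁻¹ * σ⁻¹) = fixCount (σ * σ) := by
  rw [← mul_inv_rev, fixCount_inv]

theorem sum_sumZero_four : ∑ g : alternatingGroup (Fin 4),
    (sumZero 4).toRepresentation.character g *
      (sumZero 4).toRepresentation.character (g : Perm (Fin 4))⁻¹ =
    Fintype.card (alternatingGroup (Fin 4)) := by
  refine sum_mul_inv_eq_card (c := 1) (f := fun σ => fixCount σ - 1) one_ne_zero
    (fun σ => ?_) (fun σ => by simp only [fixCount_inv]) ?_
  · rw [character_sumZero (by norm_num)]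
    push_cast
    ring
  · rw [one_pow, one_mul]
    exact_mod_cast sum_alternating_four_sumZero

theorem sum_sumZero_five : ∑ g : alternatingGroup (Fin 5),
    (sumZero 5).toRepresentation.character g *
      (sumZero 5).toRepresentation.character (g : Perm (Fin 5))⁻¹ =
    Fintype.card (alternatingGroup (Fin 5)) := by
  refine sum_mul_inv_eq_card (c := 1) (f := fun σ => fixCount σ - 1) one_ne_zero
    (fun σ => ?_) (fun σ => by simp only [fixCount_inv]) ?_
  · rw [character_sumZero (by norm_num)]
    push_cast
    ring
  · rw [one_pow, one_mul]
    exact_mod_cast sum_alternating_five_sumZero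

theorem sum_altZero_four : ∑ g : alternatingGroup (Fin 4),
    (altZero 4).toRepresentation.character g *
      (altZero 4).toRepresentation.character (g : Perm (Fin 4))⁻¹ =
    Fintype.card (alternatingGroup (Fin 4)) := by
  refine sum_mul_inv_eq_card (c := 2)
    (f := fun σ => (fixCount σ : ℤ) ^ 2 - fixCount (σ * σ) - 2 * fixCount σ + 2) two_ne_zero
    (fun σ => ?_) (fun σ => by simp only [fixCount_inv, fixCount_inv_mul_inv]) ?_
  · rw [character_altZero (by norm_num)]
    push_cast
    ring
  · rw [show (2 : ℂ) ^ 2 = 4 by norm_num]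
    exact_mod_cast sum_alternating_four_altZero

theorem sum_symZero_five : ∑ g : alternatingGroup (Fin 5),
    (symZero 5).toRepresentation.character g *
      (symZero 5).toRepresentation.character (g : Perm (Fin 5))⁻¹ =
    Fintype.card (alternatingGroup (Fin 5)) := by
  refine sum_mul_inv_eq_card (c := 2)
    (f := fun σ => (fixCount σ : ℤ) ^ 2 + fixCount (σ * σ) - 4 * fixCount σ) two_ne_zero
    (fun σ => ?_) (fun σ => by simp only [fixCount_inv, fixCount_inv_mul_inv]) ?_
  · rw [character_symZero (by norm_num)]
    push_cast
    ring
  · rw [show (2 : ℂ) ^ 2 = 4 by norm_num]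
    exact_mod_cast sum_alternating_five_symZero

end AlternatingGroup

end SpechtTheory

open SpechtTheory in
theorem mainTheorem7 (n : ℕ) (hn : 4 ≤ n) :
    let l₁ := YoungDiagram.ofRowLens [n] (by simp [List.sortedGE_iff_pairwise])
    let l₂ := YoungDiagram.ofRowLens [n - 1, 1] (by simp [List.sortedGE_iff_pairwise]; omega)
    let l₃ := YoungDiagram.ofRowLens [n - 2, 2] (by simp [List.sortedGE_iff_pairwise]; omega)
    let l₄ := YoungDiagram.ofRowLens [n - 2, 1, 1] (by simp [List.sortedGE_iff_pairwise]; omega)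
    (SpechtTheory.resAlt
        ((SpechtTheory.defRep n).tprod (SpechtTheory.defRep n))).character =
      2 • (SpechtTheory.altSpecht n l₁).character +
        3 • (SpechtTheory.altSpecht n l₂).character +
        (SpechtTheory.altSpecht n l₃).character +
        (SpechtTheory.altSpecht n l₄).character ∧
    ∀ μ ∈ ({l₁, l₂, l₃, l₄} : Set YoungDiagram), μ.transpose ≠ μ →
      (SpechtTheory.altSpecht n μ).IsIrreducible := by
  intro l₁ l₂ l₃ l₄
  have h₁ : ∀ σ, (specht n l₁).toRepresentation.character σ = 1 := character_specht_one_row _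
  have h₂ : (specht n l₂).toRepresentation.character = _ := character_specht_standard hn _
  have h₃ : (specht n l₃).toRepresentation.character = _ := character_specht_two_two hn _
  have h₄ : (specht n l₄).toRepresentation.character = _ := character_specht_hook hn _
  constructor
  · have : Module.Finite ℂ (MonoidAlgebra ℂ (Fin n)) :=
      Module.Finite.equiv (MonoidAlgebra.coeffLinearEquiv (M := Fin n) ℂ).symm
    ext g
    change ((defRep n).tprod (defRep n)).character (g : Equiv.Perm (Fin n)) =
      2 • (specht n l₁).toRepresentation.character (g : Equiv.Perm (Fin n)) +
      3 • (specht n l₂).toRepresentation.character (g : Equiv.Perm (Fin n)) +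
      (specht n l₃).toRepresentation.character (g : Equiv.Perm (Fin n)) +
      (specht n l₄).toRepresentation.character (g : Equiv.Perm (Fin n))
    rw [Representation.char_tensor, Pi.mul_apply, defRep_character, h₁, h₂, h₃, h₄]
    have a := character_sumZero (by omega : 0 < n) (g : Equiv.Perm (Fin n))
    have b := fixCount_sq (by omega : 3 ≤ n) (g : Equiv.Perm (Fin n))
    simp only [nsmul_eq_mul, Nat.cast_ofNat]
    -- Substituting fix = 1 + χ(`sumZero`) in the term 2 fix of `fixCount_sq` yields two trivial
    -- characters and raises the coefficient of χ(`sumZero`) from 1 to 3.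
    linear_combination b - 2 * a
  · have big := fun h6 : 6 ≤ n =>
      sum_char_of_patternTransitive hn _ (patternTransitive_alternating h6)
    rintro μ (rfl | rfl | rfl | rfl) hμ
    · exact altSpecht_isIrreducible (funext h₁) (by simp)
    · refine altSpecht_isIrreducible h₂ ?_
      rcases (by omega : n = 4 ∨ n = 5 ∨ 6 ≤ n) with rfl | rfl | h6
      · exact sum_sumZero_four
      · exact sum_sumZero_five
      · exact (big h6).1
    · refine altSpecht_isIrreducible h₃ ?_
      rcases (by omega : n = 4 ∨ n = 5 ∨ 6 ≤ n) with rfl | rfl | h6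
      · exact absurd (transpose_two_two _) hμ
      · exact sum_symZero_five
      · exact (big h6).2.1
    · refine altSpecht_isIrreducible h₄ ?_
      rcases (by omega : n = 4 ∨ n = 5 ∨ 6 ≤ n) with rfl | rfl | h6
      · exact sum_altZero_four
      · exact absurd (transpose_three_one_one _) hμ
      · exact (big h6).2.2
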